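/- Let $\Gamma$ be a group and $n\ge 0$ an integer. Suppose that $\Gamma$ is of type $F_{n+1}$, i.e. that $\Gamma$ admits an Eilenberg–MacLane space which is a simplicial complex with finite $(n+1)$-skeleton; in terms of its universal cover: there is a contractible simplicial complex $X$ with a free action of $\Gamma$ by simplicial automorphisms which has only finitely many orbits of simplices of dimension at most $n+1$. Let $S\subseteq\Gamma$ be a finite generating set, let $E$ be a finite-dimensional (real or complex) Banach space and let $\pi$ be a representation of $\Gamma$ on $E$, i.e. a homomorphism from $\Gamma$ to the group of invertible bounded linear operators on $E$. A representation $\rho$ of $\Gamma$ on $E$ is called an $\varepsilon$-deformation of $\pi$ if $$\sup_{s\in S}\|\pi_s-\rho_s\|_{B(E)}\le\varepsilon .$$ If $H^n(\Gamma,\pi)=0$, then there exists $\varepsilon>0$ (depending on $\Gamma$, $n$, $S$ and $\pi$) such that $H^n(\Gamma,\rho)=0$ for every $\varepsilon$-deformation $\rho$ of $\pi$. Here $H^n(\Gamma,\pi)$ denotes the group cohomology of $\Gamma$ with coefficients in the $\Gamma$-module $(E,\pi)$. -/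

import Mathlib

universe u v

/-! ### Geometric realization of an abstract simplicial complex -/

/-- The points of the geometric realization `|K|` of an abstract simplicial complex `K`, given by
their barycentric coordinates: finitely supported functions `x : V → ℝ` with nonnegative values and
total mass `1` whose support is a simplex of `K`. -/
def AbstractSimplicialComplex.Realization {V : Type*} (K : AbstractSimplicialComplex V) : Type _ :=
  {x : V →₀ ℝ // x.support ∈ K.faces ∧ (∀ v, 0 ≤ x v) ∧ (x.sum fun _ t => t) = 1}

/-- The closed simplex `|s| ⊆ |K|` spanned by `s`. -/
def AbstractSimplicialComplex.ClosedSimplex {V : Type*} (K : AbstractSimplicialComplex V)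
    (s : Finset V) : Type _ :=
  {x : K.Realization // x.1.support ⊆ s}

/-- A closed simplex carries its Euclidean topology, that is, the topology of convergence of
the barycentric coordinates (all but finitely many of which vanish on `|s|`). -/
instance {V : Type*} (K : AbstractSimplicialComplex V) (s : Finset V) :
    TopologicalSpace (K.ClosedSimplex s) :=
  TopologicalSpace.induced (fun x (v : V) => x.1.1 v) inferInstance

/-- The weak topology on `|K|`: a subset of `|K|` is open if and only if its intersection with every
closed simplex `|s|`, `s ∈ K`, is open in `|s|`. -/
instance {V : Type*} (K : AbstractSimplicialComplex V) : TopologicalSpace K.Realization :=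
  ⨆ s : K.faces, TopologicalSpace.coinduced
    (fun x : K.ClosedSimplex (s : Finset V) => x.1) inferInstance

/-! ### Groups of type `F_n` -/

/-- The image of a finite set of vertices under a group element. -/
def vertexTranslate {Γ V : Type*} [Group Γ] [MulAction Γ V] (g : Γ) (s : Finset V) : Finset V :=
  s.map (MulAction.toPerm g).toEmbedding

/-- The simplicial complex `K` with the given action of `Γ` on its vertices is (the universal cover
of) an Eilenberg-MacLane complex of `Γ` with finite `n`-skeleton: `Γ` acts freely by simplicial
automorphisms on `K`, the realization of `K` is contractible, and there are only finitely many
`Γ`-orbits of simplices of dimension at most `n`. -/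
structure IsEilenbergMacLaneComplex (Γ : Type*) [Group Γ] {V : Type*} [MulAction Γ V]
    (K : AbstractSimplicialComplex V) (n : ℕ) : Prop where
  /-- the action is simplicial -/
  simplicial : ∀ (g : Γ), ∀ s ∈ K.faces, vertexTranslate g s ∈ K.faces
  /-- the action on the realization is free: no nontrivial element maps a simplex to itself -/
  free : ∀ (g : Γ), ∀ s ∈ K.faces, vertexTranslate g s = s → g = 1
  /-- the complex is contractible -/
  contractible : ContractibleSpace K.Realization
  /-- the `n`-skeleton is finite modulo `Γ`; a `k`-simplex has `k + 1` vertices -/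
  finite_skeleton : ∃ F : Finset (Finset V), ∀ s ∈ K.faces, s.card ≤ n + 1 →
    ∃ t ∈ F, ∃ g : Γ, vertexTranslate g t = s

/-- `Γ` is of type `F_n`: it admits an Eilenberg-MacLane complex with finite `n`-skeleton. -/
def IsOfTypeF (Γ : Type u) [Group Γ] (n : ℕ) : Prop :=
  ∃ (V : Type v) (_ : MulAction Γ V) (K : AbstractSimplicialComplex V),
    IsEilenbergMacLaneComplex Γ K n

/-! ### Representations on Banach spaces, their deformations and their cohomology -/

/-- A representation of `Γ` on a Banach space `E`: a homomorphism from `Γ` to the group of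
invertible bounded linear operators on `E`. -/
abbrev BanachRep (𝕜 Γ E : Type*) [RCLike 𝕜] [Group Γ] [NormedAddCommGroup E] [NormedSpace 𝕜 E] :=
  Γ →* (E →L[𝕜] E)ˣ

/-- `ρ` is an `ε`-deformation of `π` with respect to the finite generating set `S`:
`sup_{s ∈ S} ‖π_s - ρ_s‖ ≤ ε` in operator norm. -/
def IsDeformation {𝕜 Γ E : Type*} [RCLike 𝕜] [Group Γ] [NormedAddCommGroup E] [NormedSpace 𝕜 E]
    (S : Finset Γ) (ε : ℝ) (π ρ : BanachRep 𝕜 Γ E) : Prop :=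
  ∀ s ∈ S, ‖((π s : (E →L[𝕜] E)ˣ) : E →L[𝕜] E) - ((ρ s : (E →L[𝕜] E)ˣ) : E →L[𝕜] E)‖ ≤ ε

/-- The algebraic representation underlying a representation on a Banach space. -/
def BanachRep.toRepresentation {𝕜 Γ E : Type*} [RCLike 𝕜] [Group Γ] [NormedAddCommGroup E]
    [NormedSpace 𝕜 E] (π : BanachRep 𝕜 Γ E) : Representation 𝕜 Γ E :=
  ((ContinuousLinearMap.toLinearMapRingHom : (E →L[𝕜] E) →+* (E →ₗ[𝕜] E)).toMonoidHom.comp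
    (Units.coeHom (E →L[𝕜] E))).comp π

/-- The cohomology group `H^n(Γ, π)` of `Γ` with coefficients in the `Γ`-module `(E, π)`. -/
noncomputable def BanachRep.cohomology {𝕜 Γ E : Type u} [RCLike 𝕜] [Group Γ]
    [NormedAddCommGroup E] [NormedSpace 𝕜 E] (π : BanachRep 𝕜 Γ E) (n : ℕ) : ModuleCat 𝕜 :=
  groupCohomology (Rep.of (BanachRep.toRepresentation π)) n

/-! ### Ordered chains -/

/-! Let `K` be a contractible complex on which Γ acts freely. Then H^n(Γ, ρ) can be read off from
the equivariant E-valued functions on ordered simplices of `K`, that is, on sequences of vertices,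
repetitions allowed, that span a simplex. Such a function is determined by its values on orbit
representatives. Those of lengths n, n + 1 and n + 2 are finite in number, so H^n(Γ, ρ) = 0 says
that a complex X → Y → Z of finite-dimensional spaces is exact at Y
(`cohomologyVanishes_iff_coboundary`). The spaces do not depend on ρ. The two maps involve only
finitely many operators ρ(g), and each of these is close to π(g) once ρ is close to π on S, because
g is a word in S (`tendsto_deformationFilter`).

Exactness is an open condition among complexes (`eventually_exact`): ranks cannot drop under a small
perturbation, so rank A + rank B ≥ dim Y persists, and BA = 0 then forces im A = ker B.

The rest identifies the two cohomologies. `exists_equivariant_lift` solves ∂h = D + ε h∂ one length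
at a time; it gives chain maps for D = 0, ε = 1 and homotopies for ε = -1. Hence any two free
acyclic complexes have the same vanishing (`IsFreeAcyclic.cohomologyVanishes`), in particular
`K.lists` and the sequences in Γ, which compute group cohomology.

Contractibility of the realization must still give acyclicity of `K.lists` (`isAcyclic_lists`). A
cycle is subdivided into small chains of points, and a simplicial approximation of the contraction
moves it in small steps into a single simplex. -/

/-- Chains on finite sequences of points of `V`, of all lengths at once; the empty sequence
is the augmentation. -/
abbrev ListChain (k V : Type*) [CommRing k] := List V →₀ k

namespace ListChain

variable {k : Type*} [CommRing k] {V W U : Type*}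

/-- The cone of a chain, putting the apex `v` in front of every sequence. -/
noncomputable def cone (v : V) : ListChain k V →ₗ[k] ListChain k V :=
  Finsupp.lmapDomain k k (List.cons v)

/-- The map on chains induced by a map of points. -/
noncomputable def push (f : V → W) : ListChain k V →ₗ[k] ListChain k W :=
  Finsupp.lmapDomain k k (List.map f)

/-- The boundary of a single sequence. -/
noncomputable def face (k : Type*) [CommRing k] : List V → ListChain k V
  | [] => 0
  | v :: l => Finsupp.single l 1 - cone v (face k l)

/-- The alternating boundary operator. -/
noncomputable def bdry : ListChain k V →ₗ[k] ListChain k V :=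
  Finsupp.linearCombination k (face k)

@[simp] lemma cone_single (v : V) (l : List V) (a : k) :
    cone v (Finsupp.single l a) = Finsupp.single (v :: l) a := by
  simp [cone]

@[simp] lemma push_single (f : V → W) (l : List V) (a : k) :
    push f (Finsupp.single l a) = Finsupp.single (l.map f) a := by
  simp [push]

@[simp] lemma face_nil : face k ([] : List V) = 0 := rfl

lemma face_cons (v : V) (l : List V) :
    face k (v :: l) = Finsupp.single l 1 - cone v (face k l) := rfl

@[simp] lemma bdry_single (l : List V) (a : k) : bdry (Finsupp.single l a) = a • face k l := by
  simp [bdry]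

lemma bdry_single_one (l : List V) : bdry (Finsupp.single l (1 : k)) = face k l := by simp

/-- The recursive definition of `face` makes coning a contracting homotopy. Since the complex is
augmented by the empty sequence, there is no exceptional degree. -/
lemma bdry_cone (v : V) (c : ListChain k V) : bdry (cone v c) = c - cone v (bdry c) := by
  induction c using Finsupp.induction_linear with
  | zero => simp
  | add c d hc hd => simp only [map_add, hc, hd]; abel
  | single l a => simp [face_cons, smul_sub]

lemma bdry_face (l : List V) : bdry (face k l) = 0 := by
  induction l with
  | nil => simp
  | cons v l ih => simp [face_cons, bdry_cone, ih]

lemma push_cone (f : V → W) (v : V) (c : ListChain k V) :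
    push f (cone v c) = cone (f v) (push f c) := by
  induction c using Finsupp.induction_linear with
  | zero => simp
  | add c d hc hd => simp [hc, hd]
  | single l a => simp

lemma face_map (f : V → W) (l : List V) : face k (l.map f) = push f (face k l) := by
  induction l with
  | nil => simp
  | cons v l ih => simp [face_cons, push_cone, ih]

lemma bdry_push (f : V → W) (c : ListChain k V) : bdry (push f c) = push f (bdry c) := by
  induction c using Finsupp.induction_linear with
  | zero => simp
  | add c d hc hd => simp [hc, hd]
  | single l a => simp [face_map]

lemma push_push (f : V → W) (g : W → U) (c : ListChain k V) :
    push g (push f c) = push (g ∘ f) c := by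
  induction c using Finsupp.induction_linear with
  | zero => simp
  | add c d hc hd => simp [hc, hd]
  | single l a => simp

lemma push_id (c : ListChain k V) : push id c = c := by
  induction c using Finsupp.induction_linear with
  | zero => simp
  | add c d hc hd => simp [hc, hd]
  | single l a => simp

/-! ### Supports -/

/-- The chains supported on a set of sequences. -/
noncomputable abbrev on (k : Type*) [CommRing k] (Q : Set (List V)) : Submodule k (ListChain k V) :=
  Finsupp.supported k k Q

lemma single_mem_on {Q : Set (List V)} {l : List V} (h : l ∈ Q) (a : k) :
    Finsupp.single l a ∈ on k Q := Finsupp.single_mem_supported k a h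

lemma mem_of_mem_on {Q : Set (List V)} {c : ListChain k V} (h : c ∈ on k Q) {l : List V}
    (hl : l ∈ c.support) : l ∈ Q := (Finsupp.mem_supported k c).1 h hl

lemma on_mono {Q R : Set (List V)} {c : ListChain k V} (hc : c ∈ on k Q) (h : ∀ l ∈ Q, l ∈ R) :
    c ∈ on k R := Finsupp.supported_mono h hc

/-- A linear map sends chains on `Q` into a submodule as soon as it sends sequences there. -/
lemma map_mem_of_single {M : Type*} [AddCommGroup M] [Module k M] {Q : Set (List V)}
    {A : Submodule k M} (T : ListChain k V →ₗ[k] M)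
    (h : ∀ l ∈ Q, T (Finsupp.single l 1) ∈ A) {c : ListChain k V} (hc : c ∈ on k Q) :
    T c ∈ A := by
  rw [on, Finsupp.supported_eq_span_single] at hc
  have : Submodule.span k ((fun l => Finsupp.single l (1 : k)) '' Q) ≤ A.comap T := by
    rw [Submodule.span_le]
    rintro _ ⟨l, hl, rfl⟩
    exact h l hl
  exact this hc

/-- Two linear maps which agree on the sequences in `Q` agree on the chains on `Q`. -/
lemma eq_of_single {M : Type*} [AddCommGroup M] [Module k M] {Q : Set (List V)}
    (S T : ListChain k V →ₗ[k] M)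
    (h : ∀ l ∈ Q, S (Finsupp.single l 1) = T (Finsupp.single l 1)) {c : ListChain k V}
    (hc : c ∈ on k Q) : S c = T c := by
  have := map_mem_of_single (A := ⊥) (S - T) (fun l hl => by simp [h l hl]) hc
  simpa [sub_eq_zero] using this

lemma cone_mem_on {Q R : Set (List V)} {v : V} (h : ∀ l ∈ Q, v :: l ∈ R) {c : ListChain k V}
    (hc : c ∈ on k Q) : cone v c ∈ on k R :=
  map_mem_of_single _ (fun l hl => by simpa using single_mem_on (h l hl) (1 : k)) hc

lemma push_mem_on {Q : Set (List V)} {R : Set (List W)} {f : V → W}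
    (h : ∀ l ∈ Q, l.map f ∈ R) {c : ListChain k V}
    (hc : c ∈ on k Q) : push f c ∈ on k R :=
  map_mem_of_single _ (fun l hl => by simpa using single_mem_on (h l hl) (1 : k)) hc

lemma face_mem_on (l : List V) :
    face k l ∈ on k {m : List V | m.Sublist l ∧ m.length + 1 = l.length} := by
  induction l with
  | nil => simp
  | cons v l ih =>
    rw [face_cons]
    refine Submodule.sub_mem _ (single_mem_on (by simp) 1) (cone_mem_on ?_ ih)
    rintro m ⟨h1, h2⟩
    exact ⟨h1.cons_cons v, by simp [h2]⟩

lemma bdry_mem_on {Q R : Set (List V)}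
    (h : ∀ l ∈ Q, ∀ m : List V, m.Sublist l → m.length + 1 = l.length → m ∈ R)
    {c : ListChain k V} (hc : c ∈ on k Q) : bdry c ∈ on k R := by
  refine map_mem_of_single _ (fun l hl => ?_) hc
  rw [bdry_single_one]
  exact Finsupp.supported_mono (fun m hm => h l hl m hm.1 hm.2) (face_mem_on l)

/-- The component of a chain on sequences of length `m`. -/
noncomputable def ofLength (m : ℕ) : ListChain k V →ₗ[k] ListChain k V :=
  Finsupp.linearCombination k fun l => if l.length = m then Finsupp.single l 1 else 0

lemma ofLength_of_mem {m : ℕ} {c : ListChain k V} (hc : c ∈ on k {l : List V | l.length = m}) :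
    ofLength m c = c :=
  eq_of_single (ofLength m) LinearMap.id (fun l (hl : l.length = m) => by simp [ofLength, hl]) hc

lemma ofLength_of_disjoint {m : ℕ} {c : ListChain k V}
    (hc : c ∈ on k {l : List V | l.length ≠ m}) : ofLength m c = 0 :=
  eq_of_single (ofLength m) 0 (fun l (hl : l.length ≠ m) => by simp [ofLength, hl]) hc

lemma ofLength_mem {Q : Set (List V)} {m : ℕ} {c : ListChain k V} (hc : c ∈ on k Q) :
    ofLength m c ∈ on k {l | l ∈ Q ∧ l.length = m} := by
  refine map_mem_of_single _ (fun l hl => ?_) hc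
  by_cases h : l.length = m
  · simpa [ofLength, h] using single_mem_on (Q := {l | l ∈ Q ∧ l.length = m}) ⟨hl, h⟩ (1 : k)
  · simp [ofLength, h]

lemma bdry_ofLength (m : ℕ) (c : ListChain k V) :
    bdry (ofLength (m + 1) c) = ofLength m (bdry c) := by
  induction c using Finsupp.induction_linear with
  | zero => simp
  | add c d hc hd => simp [hc, hd]
  | single l a =>
    by_cases h : l.length = m + 1
    · rw [ofLength_of_mem (single_mem_on (by simpa using h) a), ofLength_of_mem]
      exact bdry_mem_on (Q := {l | l.length = m + 1}) (fun l hl m' _ h2 => by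
        simp only [Set.mem_ofPred_eq] at hl ⊢; omega) (single_mem_on h a)
    · rw [ofLength_of_disjoint (single_mem_on (by simpa using h) a), ofLength_of_disjoint, map_zero]
      exact bdry_mem_on (Q := {l | l.length ≠ m + 1}) (fun l hl m' _ h2 => by
        simp only [Set.mem_ofPred_eq] at hl ⊢; omega) (single_mem_on h a)

/-! ### Acyclicity -/

/-- Every cycle on `Q` is the boundary of a chain on `Q`. -/
def IsAcyclic (k : Type*) [CommRing k] (Q : Set (List V)) : Prop :=
  ∀ c ∈ on k Q, bdry c = 0 → ∃ b ∈ on k Q, bdry b = c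

lemma isAcyclic_of_cone {Q : Set (List V)} (v : V) (h : ∀ l ∈ Q, v :: l ∈ Q) :
    IsAcyclic k Q := fun c hc hz =>
  ⟨cone v c, cone_mem_on h hc, by simp [bdry_cone, hz]⟩

/-- The boundary lowers length by exactly one, so the components of a filling in other lengths can
be discarded. -/
lemma IsAcyclic.exists_ofLength {Q : Set (List V)} (h : IsAcyclic k Q) {m : ℕ}
    {c : ListChain k V} (hc : c ∈ on k {l | l ∈ Q ∧ l.length = m}) (hz : bdry c = 0) :
    ∃ b ∈ on k {l | l ∈ Q ∧ l.length = m + 1}, bdry b = c := by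
  obtain ⟨b, hb, rfl⟩ := h c (Finsupp.supported_mono (fun l hl => hl.1) hc) hz
  exact ⟨ofLength (m + 1) b, ofLength_mem hb, by
    rw [bdry_ofLength, ofLength_of_mem (Finsupp.supported_mono (fun l hl => hl.2) hc)]⟩

/-! ### Acyclic carriers -/

/-- Extend a function on sequences to chains. -/
noncomputable abbrev ext {M : Type*} [AddCommGroup M] [Module k M] (h : List V → M) :
    ListChain k V →ₗ[k] M := Finsupp.linearCombination k h

lemma ext_congr {M : Type*} [AddCommGroup M] [Module k M] {Q : Set (List V)} {f g : List V → M}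
    (h : ∀ l ∈ Q, f l = g l) {c : ListChain k V} (hc : c ∈ on k Q) : ext f c = ext g c :=
  eq_of_single _ _ (fun l hl => by simp [h l hl]) hc

/-- Equivariant acyclic carriers: solve `∂ (h l) = D l + ε • h (∂ l)` by recursion on the length
of `l`, with `h l` in the carrier `A l`. The function `γ` trivializes the free action. -/
theorem exists_equivariant_lift {Γ : Type*} [Group Γ] [MulAction Γ V] [MulAction Γ W]
    (γ : V → Γ) (hγ : ∀ (g : Γ) v, γ (g • v) = g * γ v)
    (P : Set (List V)) (hP : ∀ l ∈ P, ∀ m : List V, m.Sublist l → m ∈ P)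
    (hPg : ∀ (g : Γ), ∀ l ∈ P, l.map (g • ·) ∈ P)
    (A B : List V → Submodule k (ListChain k W))
    (hA : ∀ (g : Γ), ∀ l ∈ P, ∀ c ∈ A l, push (g • ·) c ∈ A (l.map (g • ·)))
    (ε : k) (D : List V → ListChain k W) (hDB : ∀ l ∈ P, D l ∈ B l)
    (hDg : ∀ (g : Γ), ∀ l ∈ P, D (l.map (g • ·)) = push (g • ·) (D l))
    (hDε : ∀ l ∈ P, bdry (D l) + ε • ext D (face k l) = 0)
    (hAB : ∀ l ∈ P, ∀ m : List V, m.Sublist l → m.length + 1 = l.length → A m ≤ B l)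
    (fill : ∀ l ∈ P, l ≠ [] → ∀ c ∈ B l, bdry c = 0 → ∃ b ∈ A l, bdry b = c)
    (z : ListChain k W) (hzA : z ∈ A []) (hzD : bdry z = D [])
    (hzg : ∀ g : Γ, push (g • ·) z = z) :
    ∃ h : List V → ListChain k W, h [] = z ∧ ∀ l ∈ P, h l ∈ A l ∧
      bdry (h l) = D l + ε • ext h (face k l) ∧
      ∀ g : Γ, h (l.map (g • ·)) = push (g • ·) (h l) := by
  classical
  -- The hypotheses move inside the existential so that the choice of fillings is a total function,
  -- available before the cycle condition is known.
  have fill' : ∀ (l : List V) (c : ListChain k W), ∃ b, l ∈ P → l ≠ [] → c ∈ B l → bdry c = 0 →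
      b ∈ A l ∧ bdry b = c := by
    intro l c
    by_cases H : l ∈ P ∧ l ≠ [] ∧ c ∈ B l ∧ bdry c = 0
    · obtain ⟨b, h1, h2⟩ := fill l H.1 H.2.1 c H.2.2.1 H.2.2.2
      exact ⟨b, fun _ _ _ _ => ⟨h1, h2⟩⟩
    · exact ⟨0, fun h1 h2 h3 h4 => (H ⟨h1, h2, h3, h4⟩).elim⟩
  choose F hF using fill'
  -- Translate the sequence so that `γ` of its head becomes 1, fill there, and translate back.
  -- Filling only at normalized sequences makes the result equivariant.
  obtain ⟨step, step_nil, step_cons⟩ :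
      ∃ step : (List V → ListChain k W) → List V → ListChain k W,
        (∀ h, step h [] = z) ∧ ∀ h v t, step h (v :: t) =
          push (γ v • ·) (F ((v :: t).map ((γ v)⁻¹ • ·)) (D ((v :: t).map ((γ v)⁻¹ • ·)) +
            ε • ext h (face k ((v :: t).map ((γ v)⁻¹ • ·))))) :=
    ⟨fun h l => l.casesOn z fun v t =>
      push (γ v • ·) (F ((v :: t).map ((γ v)⁻¹ • ·)) (D ((v :: t).map ((γ v)⁻¹ • ·)) +
            ε • ext h (face k ((v :: t).map ((γ v)⁻¹ • ·))))), fun _ => rfl, fun _ _ _ => rfl⟩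
  -- The recursion on length is realized by iterating `step`: since `step h l` only uses `h` on
  -- sequences one shorter, `H n` is stable on lengths at most `n`.
  obtain ⟨H, H_zero, H_succ⟩ : ∃ H : ℕ → List V → ListChain k W,
      (∀ l, H 0 l = z) ∧ ∀ n l, H (n + 1) l = step (H n) l :=
    ⟨fun n => Nat.rec (fun _ => z) (fun _ h => step h) n, fun _ => rfl, fun _ _ => rfl⟩
  have hstep : ∀ h h' : List V → ListChain k W, ∀ l : List V,
      (∀ m : List V, m.length + 1 = l.length → h m = h' m) → step h l = step h' l := by
    intro h h' l hh
    cases l with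
    | nil => rw [step_nil, step_nil]
    | cons v t =>
      rw [step_cons, step_cons]
      congr 4
      refine ext_congr (fun m hm => hh m ?_) (face_mem_on (k := k) _)
      simpa using hm.2
  have hH : ∀ n, ∀ l : List V, l.length ≤ n → H n l = H l.length l := by
    intro n
    induction n with
    | zero => intro l hl; obtain rfl : l = [] := by simpa using hl
              rfl
    | succ n ih =>
      intro l hl
      cases l with
      | nil => rw [H_succ, step_nil, List.length_nil, H_zero]
      | cons v t =>
        rw [H_succ, List.length_cons, H_succ]
        refine hstep _ _ _ (fun m hm => ?_)
        simp only [List.length_cons, Nat.add_right_cancel_iff] at hm hl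
        rw [ih m (by omega), ← hm]
  obtain ⟨h, hdef⟩ : ∃ h : List V → ListChain k W, ∀ l, h l = H l.length l := ⟨_, fun _ => rfl⟩
  have h_nil : h [] = z := by rw [hdef, List.length_nil, H_zero]
  have hfix : ∀ l, h l = step h l := by
    intro l
    cases l with
    | nil => rw [h_nil, step_nil]
    | cons v t =>
      rw [hdef, List.length_cons, H_succ]
      refine hstep _ _ _ (fun m hm => ?_)
      simp only [List.length_cons, Nat.add_right_cancel_iff] at hm
      rw [hdef, hm]
  have smap : ∀ (g g' : Γ) (l : List V),
      (l.map (g • ·)).map (g' • ·) = l.map ((g' * g) • ·) := by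
    intro g g' l; simp [mul_smul]
  have spush : ∀ (g g' : Γ) (c : ListChain k W),
      push (g' • ·) (push (g • ·) c) = push ((g' * g) • ·) c := by
    intro g g' c; rw [push_push]; congr 2; ext x; simp [mul_smul]
  have hequi : ∀ (g : Γ) l, h (l.map (g • ·)) = push (g • ·) (h l) := by
    intro g l
    rw [hfix, hfix l]
    cases l with
    | nil => rw [List.map_nil, step_nil, hzg]
    | cons v t =>
      -- A sequence and its translate have the same normalized representative, hence the same chosen
      -- filling.
      have e : ((g • v) :: t.map (g • ·)).map ((γ (g • v))⁻¹ • ·)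
          = (v :: t).map ((γ v)⁻¹ • ·) := by
        have := smap g (γ (g • v))⁻¹ (v :: t)
        rw [List.map_cons] at this
        rw [this, hγ]
        simp
      rw [List.map_cons, step_cons, step_cons, e, spush, hγ]
  have key : ∀ n, ∀ l ∈ P, l.length ≤ n → h l ∈ A l ∧ bdry (h l) = D l + ε • ext h (face k l) := by
    intro n
    induction n with
    | zero =>
      intro l _ hl
      obtain rfl : l = [] := by simpa using hl
      exact ⟨by rwa [h_nil], by simpa [h_nil] using hzD⟩
    | succ n ih =>
      intro l hl hn
      cases l with
      | nil => exact ⟨by rwa [h_nil], by simpa [h_nil] using hzD⟩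
      | cons v t =>
        set r := (v :: t).map ((γ v)⁻¹ • ·) with hr
        have hrP : r ∈ P := hPg _ _ hl
        have hrl : r.map (γ v • ·) = v :: t := by rw [hr, smap]; simp
        have hfaces : face k r ∈ on k {m | m ∈ P ∧ m.Sublist r ∧ m.length + 1 = r.length} := by
          refine Finsupp.supported_mono (fun m hm => ?_) (face_mem_on r)
          exact ⟨hP r hrP m hm.1, hm.1, hm.2⟩
        have hlen : r.length = t.length + 1 := by simp [hr]
        have hIH : ∀ m ∈ {m | m ∈ P ∧ m.Sublist r ∧ m.length + 1 = r.length},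
            h m ∈ A m ∧ bdry (h m) = D m + ε • ext h (face k m) := fun m hm =>
          ih m hm.1 (by have := hm.2.2; simp only [List.length_cons] at hn; omega)
        have hB : D r + ε • ext h (face k r) ∈ B r := by
          refine Submodule.add_mem _ (hDB r hrP) (Submodule.smul_mem _ _ ?_)
          refine map_mem_of_single _ (fun m hm => ?_) hfaces
          simpa using hAB r hrP m hm.2.1 hm.2.2 (hIH m hm).1
        -- By induction ∂h = D + ε h∂ on the faces of `r`; since ∂∂ = 0, the boundary in question
        -- reduces to ∂D + ε D∂, which is zero by `hDε`.
        have hcyc : bdry (D r + ε • ext h (face k r)) = 0 := by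
          have : bdry (ext h (face k r)) = ext D (face k r) := by
            have e1 := eq_of_single (bdry ∘ₗ ext h) (ext D + ε • (ext h ∘ₗ bdry)) (fun m hm => by simpa using (hIH m hm).2) hfaces
            simpa [bdry_face] using e1
          rw [map_add, map_smul, this]
          exact hDε r hrP
        have hne : r ≠ [] := by simp [hr]
        obtain ⟨hF1, hF2⟩ := hF r _ hrP hne hB hcyc
        have hval : h (v :: t) = push (γ v • ·) (F r (D r + ε • ext h (face k r))) := by
          rw [hfix, step_cons]
        refine ⟨?_, ?_⟩
        · rw [hval]
          have := hA (γ v) r hrP _ hF1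
          rwa [hrl] at this
        · rw [hval, bdry_push, hF2, map_add, map_smul, ← hDg _ _ hrP, hrl]
          congr 2
          conv_rhs => rw [← hrl, face_map]
          have : (push (γ v • ·) ∘ₗ ext h) (face k r) = (ext h ∘ₗ push (γ v • ·)) (face k r) := by
            congr 1
            ext m : 2
            simp [hequi]
          exact this
  exact ⟨h, h_nil, fun l hl => ⟨(key _ l hl le_rfl).1, (key _ l hl le_rfl).2, fun g => hequi g l⟩⟩

/-- Acyclic carriers, without a group action. -/
theorem exists_lift (P : Set (List V)) (hP : ∀ l ∈ P, ∀ m : List V, m.Sublist l → m ∈ P)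
    (A : List V → Submodule k (ListChain k W))
    (ε : k) (D : List V → ListChain k W) (hDA : ∀ l ∈ P, D l ∈ A l)
    (hDε : ∀ l ∈ P, bdry (D l) + ε • ext D (face k l) = 0)
    (hAA : ∀ l ∈ P, ∀ m : List V, m.Sublist l → A m ≤ A l)
    (fill : ∀ l ∈ P, l ≠ [] → ∀ c ∈ A l, bdry c = 0 → ∃ b ∈ A l, bdry b = c)
    (z : ListChain k W) (hzA : z ∈ A []) (hzD : bdry z = D []) :
    ∃ h : List V → ListChain k W, h [] = z ∧ ∀ l ∈ P, h l ∈ A l ∧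
      bdry (h l) = D l + ε • ext h (face k l) := by
  -- The trivial group acting trivially turns the equivariant statement into this one.
  let _ : MulAction Unit V := 
    { smul := fun _ x => x, one_smul := fun _ => rfl, mul_smul := fun _ _ _ => rfl }
  let _ : MulAction Unit W := 
    { smul := fun _ x => x, one_smul := fun _ => rfl, mul_smul := fun _ _ _ => rfl }
  have e : ∀ (g : Unit) (l : List V), l.map (g • ·) = l := fun _ l => l.map_id
  have e' : ∀ (g : Unit) (c : ListChain k W), push (g • ·) c = c := fun _ c => push_id c
  obtain ⟨h, h0, h1⟩ := exists_equivariant_lift (Γ := Unit) (fun _ => 1) (fun _ _ => rfl) P hP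
    (fun g l hl => by rwa [e]) A A (fun g l _ c hc => by rwa [e, e'])
    ε D hDA (fun g l hl => by rw [e, e']) hDε (fun l hl m hm _ => hAA l hl m hm)
    fill z hzA hzD (fun g => e' g z)
  exact ⟨h, h0, fun l hl => ⟨(h1 l hl).1, (h1 l hl).2.1⟩⟩

/-- Two chain maps which agree on `[]` and differ by chains in a sublist-monotone acyclic carrier
differ on cycles by boundaries in the carrier. -/
theorem exists_bdry_eq_of_carrier {P : Set (List V)}
    (hP : ∀ l ∈ P, ∀ m : List V, m.Sublist l → m ∈ P) {Q : Set (List W)}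
    (A : List V → Set (List W)) (hAQ : ∀ l ∈ P, l ≠ [] → A l ⊆ Q)
    (T : ListChain k V →ₗ[k] ListChain k W) (hT0 : T (Finsupp.single [] 1) = 0)
    (hT : ∀ l ∈ P, bdry (T (Finsupp.single l 1)) = T (face k l))
    (hTA : ∀ l ∈ P, T (Finsupp.single l 1) ∈ on k (A l))
    (hAA : ∀ l ∈ P, ∀ m : List V, m.Sublist l → A m ⊆ A l)
    (hac : ∀ l ∈ P, l ≠ [] → IsAcyclic k (A l))
    {c : ListChain k V} (hc : c ∈ on k P) (hz : bdry c = 0) :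
    ∃ b ∈ on k Q, bdry b = T c := by
  have hext : ext (fun l => T (Finsupp.single l 1)) = T := by ext l : 2; simp
  -- With ε = -1 the equation becomes ∂h = T - h∂, a null-homotopy of `T` inside the carrier.
  obtain ⟨h, h0, h1⟩ := exists_lift P hP (fun l => on k (A l)) (-1)
    (fun l => T (Finsupp.single l 1)) hTA (fun l hl => by rw [hext, hT l hl]; simp)
    (fun l hl m hm => Finsupp.supported_mono (hAA l hl m hm)) (fun l hl hne => hac l hl hne) 0 (by simp)
    (by simp [hT0])
  refine ⟨ext h c, map_mem_of_single _ (fun l hl => ?_) hc, ?_⟩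
  · by_cases hne : l = []
    · simp [hne, h0]
    · simpa using Finsupp.supported_mono (hAQ l hl hne) (h1 l hl).1
  · have := eq_of_single (bdry ∘ₗ ext h) (T - ext h ∘ₗ bdry) (fun l hl => by simpa [sub_eq_add_neg] using (h1 l hl).2) hc
    simpa [hz] using this

/-- Contiguous maps agree on cycles up to boundaries. -/
theorem exists_bdry_eq_of_contiguous {Q : Set (List W)} (f g : V → W) {P : Set (List V)}
    (hP : ∀ l ∈ P, ∀ m : List V, m.Sublist l → m ∈ P)
    (h : ∀ l ∈ P, ∀ m : List W, (∀ x ∈ m, ∃ v ∈ l, x = f v ∨ x = g v) → m ∈ Q)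
    {c : ListChain k V} (hc : c ∈ on k P) (hz : bdry c = 0) :
    ∃ b ∈ on k Q, bdry b = push f c - push g c := by
  refine exists_bdry_eq_of_carrier hP (fun l => {m | ∀ x ∈ m, ∃ v ∈ l, x = f v ∨ x = g v})
    (fun l hl _ m hm => h l hl m hm) (push f - push g) (by simp) (fun l hl => ?_) (fun l hl => ?_)
    (fun l hl m hm t ht x hx => ?_) (fun l hl hne => ?_) hc hz
  · simp [face_map]
  · simp only [LinearMap.sub_apply, push_single]
    refine Submodule.sub_mem _ (single_mem_on ?_ 1) (single_mem_on ?_ 1)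
    · intro x hx
      obtain ⟨v, hv, rfl⟩ := List.mem_map.1 hx
      exact ⟨v, hv, Or.inl rfl⟩
    · intro x hx
      obtain ⟨v, hv, rfl⟩ := List.mem_map.1 hx
      exact ⟨v, hv, Or.inr rfl⟩
  · obtain ⟨v, hv, h'⟩ := ht x hx
    exact ⟨v, hm.subset hv, h'⟩
  · obtain ⟨v, hv⟩ := List.exists_mem_of_ne_nil l hne
    refine isAcyclic_of_cone (f v) (fun m hm x hx => ?_)
    rcases List.mem_cons.1 hx with rfl | hx
    · exact ⟨v, hv, Or.inl rfl⟩
    · exact hm x hx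

end ListChain

/-! ### Small chains in a convex set -/

lemma Submodule.sub_mem_of_telescope {R M : Type*} [Ring R] [AddCommGroup M] [Module R M]
    (B : Submodule R M) (u : ℕ → M) (N : ℕ) (h : ∀ i < N, u i - u (i + 1) ∈ B) :
    u 0 - u N ∈ B := by
  induction N with
  | zero => simp
  | succ N ih =>
    have := B.add_mem (ih fun i hi => h i (by omega)) (h N (by omega))
    simpa using this

namespace ListChain

variable {k : Type*} [CommRing k]

/-- The sequences of points of `C` which are pairwise at distance less than `δ`. -/
def small {Y : Type*} [Dist Y] (C : Set Y) (δ : ℝ) : Set (List Y) :=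
  {l | (∀ x ∈ l, x ∈ C) ∧ ∀ x ∈ l, ∀ y ∈ l, dist x y < δ}

lemma small_sublist {Y : Type*} [Dist Y] {C : Set Y} {δ : ℝ} {l : List Y} (hl : l ∈ small C δ)
    {m : List Y} (hm : m.Sublist l) : m ∈ small C δ :=
  ⟨fun x hx => hl.1 x (hm.subset hx), fun x hx y hy => hl.2 x (hm.subset hx) y (hm.subset hy)⟩

/-- A cycle is contracted linearly to `p` in finitely many steps, so short that consecutive stages
are contiguous through δ-small sequences. Its final image is supported on sequences constant at `p`,
where coning applies. -/
lemma isAcyclic_small {Y : Type*} [NormedAddCommGroup Y] [NormedSpace ℝ Y] {C : Set Y}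
    (hC : Convex ℝ C) {p : Y} (hp : p ∈ C) {δ : ℝ} (hδ : 0 < δ) : IsAcyclic k (small C δ) := by
  intro c hc hz
  -- The support of `c` is finite and its distances are strictly below δ, so there is room for a
  -- step size η. Two points moved by parameters differing by at most η are at distance at most
  -- `dist x y + η * dist y p`.
  have hev : ∀ᶠ η in nhds (0 : ℝ), ∀ l ∈ c.support, ∀ x ∈ l, ∀ y ∈ l,
      dist x y + η * dist y p < δ := by
    refine (Filter.eventually_all_finset _).2 fun l hl => ?_
    refine (Filter.eventually_all_finite l.finite_toSet).2 fun x hx => ?_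
    refine (Filter.eventually_all_finite l.finite_toSet).2 fun y hy => ?_
    have hcont : Filter.Tendsto (fun η : ℝ => dist x y + η * dist y p) (nhds 0)
        (nhds (dist x y + 0 * dist y p)) := by
      apply Continuous.tendsto
      fun_prop
    refine hcont.eventually_lt_const ?_
    simpa using (mem_of_mem_on hc hl).2 x hx y hy
  obtain ⟨n, hn⟩ := ((tendsto_one_div_add_atTop_nhds_zero_nat (𝕜 := ℝ)).eventually hev).exists
  set η : ℝ := 1 / ((n : ℝ) + 1) with hη
  have hη0 : 0 ≤ η := by positivity
  let f : ℝ → Y → Y := fun t x => (1 - t) • x + t • p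
  have hdist : ∀ t t' x y, 0 ≤ t → t ≤ 1 → |t' - t| ≤ η →
      dist (f t x) (f t' y) ≤ dist x y + η * dist y p := by
    intro t t' x y h0 h1 h2
    have e : f t x - f t' y = (1 - t) • (x - y) + (t' - t) • (y - p) := by
      simp only [f]; module
    rw [dist_eq_norm, e, dist_eq_norm, dist_eq_norm]
    refine (norm_add_le _ _).trans (add_le_add ?_ ?_)
    · rw [norm_smul, Real.norm_eq_abs, abs_of_nonneg (by linarith)]
      exact mul_le_of_le_one_left (norm_nonneg _) (by linarith)
    · rw [norm_smul, Real.norm_eq_abs]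
      gcongr
  have hfC : ∀ t x, 0 ≤ t → t ≤ 1 → x ∈ C → f t x ∈ C := fun t x h0 h1 hx =>
    hC hx hp (by linarith) h0 (by ring)
  let P : Set (List Y) :=
    {l | (∀ x ∈ l, x ∈ C) ∧ ∀ x ∈ l, ∀ y ∈ l, dist x y + η * dist y p < δ}
  have hcP : c ∈ on k P := (Finsupp.mem_supported _ _).2 fun l hl =>
    ⟨(mem_of_mem_on hc hl).1, hn l hl⟩
  have hstep : ∀ i < n + 1, push (f (i * η)) c - push (f ((i + 1 : ℕ) * η)) c ∈
      (on k (small C δ)).map bdry := by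
    intro i hi
    have hi' : ((i + 1 : ℕ) : ℝ) * η ≤ 1 := by
      rw [hη, mul_one_div, div_le_one (by positivity)]
      exact_mod_cast hi
    have h0 : 0 ≤ (i : ℝ) * η := by positivity
    have hle : (i : ℝ) * η ≤ ((i + 1 : ℕ) : ℝ) * η := by push_cast; nlinarith
    refine Submodule.mem_map.2 (exists_bdry_eq_of_contiguous (P := P) _ _
      (fun l hl m hm => ⟨fun x hx => hl.1 x (hm.subset hx),
        fun x hx y hy => hl.2 x (hm.subset hx) y (hm.subset hy)⟩) (fun l hl m hm => ?_) hcP hz)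
    have hm' : ∀ x ∈ m, ∃ v ∈ l, ∃ t, 0 ≤ t ∧ t ≤ 1 ∧ (t = i * η ∨ t = (i + 1 : ℕ) * η) ∧
        x = f t v := by
      intro x hx
      obtain ⟨v, hv, h | h⟩ := hm x hx
      · exact ⟨v, hv, _, h0, hle.trans hi', Or.inl rfl, h⟩
      · exact ⟨v, hv, _, h0.trans hle, hi', Or.inr rfl, h⟩
    refine ⟨fun x hx => ?_, fun x hx y hy => ?_⟩
    · obtain ⟨v, hv, t, ht0, ht1, -, rfl⟩ := hm' x hx
      exact hfC t v ht0 ht1 (hl.1 v hv)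
    · obtain ⟨v, hv, t, ht0, ht1, ht, rfl⟩ := hm' x hx
      obtain ⟨w, hw, s, hs0, hs1, hs, rfl⟩ := hm' y hy
      refine (hdist t s v w ht0 ht1 ?_).trans_lt (hl.2 v hv w hw)
      have e : ((i + 1 : ℕ) : ℝ) * η - i * η = η := by push_cast; ring
      rcases ht with rfl | rfl <;> rcases hs with rfl | rfl
      · simpa using hη0
      · rw [e, abs_of_nonneg hη0]
      · rw [abs_sub_comm, e, abs_of_nonneg hη0]
      · simpa using hη0
  have htel := Submodule.sub_mem_of_telescope _ (fun i : ℕ => push (f (i * η)) c) (n + 1) hstep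
  have e0 : f ((0 : ℕ) * η) = id := by ext x; simp [f]
  have e1 : f ((n + 1 : ℕ) * η) = fun _ => p := by
    have : ((n + 1 : ℕ) : ℝ) * η = 1 := by rw [hη]; push_cast; field_simp
    ext x; rw [this]; simp [f]
  rw [e0, e1, push_id] at htel
  have hconst : push (fun _ => p) c ∈ (on k (small C δ)).map bdry := by
    have h1 : push (fun _ : Y => p) c ∈ on k {l : List Y | ∀ x ∈ l, x = p} :=
      push_mem_on (Q := Set.univ) (fun l _ x hx => by
        obtain ⟨_, _, rfl⟩ := List.mem_map.1 hx; rfl) (by simp [on])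
    obtain ⟨b, hb, hb'⟩ := isAcyclic_of_cone (k := k) (Q := {l : List Y | ∀ x ∈ l, x = p}) p
      (fun l hl x hx => (List.mem_cons.1 hx).elim id (hl x)) _ h1 (by rw [bdry_push, hz, map_zero])
    refine ⟨b, on_mono hb fun l hl => ⟨fun x hx => ?_, fun x hx y hy => ?_⟩, hb'⟩
    · rw [hl x hx]; exact hp
    · rw [hl x hx, hl y hy, dist_self]; exact hδ
  have := Submodule.add_mem _ htel hconst
  rw [sub_add_cancel] at this
  exact Submodule.mem_map.1 this

end ListChain

/-! ### The realization of a simplicial complex -/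

namespace AbstractSimplicialComplex

variable {V : Type*} (K : AbstractSimplicialComplex V)

lemma mem_faces_of_subset {s t : Finset V} (hs : s ∈ K.faces) (ht : t ⊆ s) (hne : t.Nonempty) :
    t ∈ K.faces := (K.isRelLowerSet_faces hs).2 ht hne

lemma continuous_coord (v : V) : Continuous fun x : K.Realization => x.1 v := by
  refine continuous_iSup_dom.2 fun s => continuous_coinduced_dom.2 ?_
  exact (continuous_apply v).comp continuous_induced_dom

lemma continuous_closedSimplex {s : Finset V} (hs : s ∈ K.faces) :
    Continuous fun x : K.ClosedSimplex s => x.1 :=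
  continuous_iff_coinduced_le.2 (le_iSup (fun s : K.faces => TopologicalSpace.coinduced
    (fun x : K.ClosedSimplex (s : Finset V) => x.1) inferInstance) ⟨s, hs⟩)

/-- Barycentric coordinates of the points of `|K|` lying over the finite set of vertices `W`. -/
def polyhedron (W : Finset V) : Set (W → ℝ) :=
  {y | (∀ w, 0 ≤ y w) ∧ ∑ w, y w = 1 ∧ ∃ s ∈ K.faces, ∀ w, y w ≠ 0 → (w : V) ∈ s}

variable {K} {W : Finset V}

open Classical in
/-- The point of `|K|` with given barycentric coordinates. -/
noncomputable def polyhedron.toRealization (y : K.polyhedron W) : K.Realization :=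
  ⟨Finsupp.onFinset W (fun v => if h : v ∈ W then y.1 ⟨v, h⟩ else 0) (fun v hv => by
      by_contra h; simp [h] at hv), by
    have hsum : ((Finsupp.onFinset W (fun v => if h : v ∈ W then y.1 ⟨v, h⟩ else 0) (fun v hv => by
      by_contra h; simp [h] at hv)).sum fun _ t => t) = 1 := by
      rw [Finsupp.onFinset_sum _ (fun _ => rfl), ← Finset.sum_attach, ← y.2.2.1]
      exact Finset.sum_congr rfl fun w _ => by simp
    refine ⟨?_, fun v => ?_, hsum⟩
    · obtain ⟨s, hs, hs'⟩ := y.2.2.2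
      refine K.mem_faces_of_subset hs (fun v hv => ?_) ?_
      · rw [Finsupp.mem_support_iff, Finsupp.onFinset_apply] at hv
        by_cases h : v ∈ W
        · exact hs' ⟨v, h⟩ (by simpa [h] using hv)
        · simp [h] at hv
      · rw [Finsupp.support_nonempty_iff]
        intro h0
        rw [h0] at hsum
        simp at hsum
    · rw [Finsupp.onFinset_apply]
      split_ifs with h
      · exact y.2.1 _
      · exact le_rfl⟩

open Classical in
lemma polyhedron.toRealization_apply (y : K.polyhedron W) (v : V) :
    (polyhedron.toRealization y).1 v = if h : v ∈ W then y.1 ⟨v, h⟩ else 0 := rfl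

lemma polyhedron.mem_of_toRealization_ne_zero {y : K.polyhedron W} {v : V}
    (h : (polyhedron.toRealization y).1 v ≠ 0) : ∃ w : W, (w : V) = v ∧ y.1 w ≠ 0 := by
  classical
  rw [polyhedron.toRealization_apply] at h
  split_ifs at h with hv
  · exact ⟨⟨v, hv⟩, rfl, h⟩
  · exact (h rfl).elim

variable (K W) in
/-- The part of the polyhedron lying over the vertices in `i`. -/
def polyhedronPart (i : Finset W) : Set (K.polyhedron W) := {y | ∀ w, w ∉ i → y.1 w = 0}

lemma isClosed_polyhedronPart (i : Finset W) : IsClosed (K.polyhedronPart W i) := by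
  have : K.polyhedronPart W i = ⋂ w, ⋂ _ : w ∉ i, {y | y.1 w = 0} := by
    ext y; simp [polyhedronPart]
  rw [this]
  refine isClosed_iInter fun w => isClosed_iInter fun _ => isClosed_eq ?_ continuous_const
  exact (continuous_apply w).comp continuous_subtype_val

lemma iUnion_polyhedronPart :
    ⋃ i : {i : Finset W // i.map (Function.Embedding.subtype _) ∈ K.faces},
      K.polyhedronPart W i = Set.univ := by
  classical
  refine Set.eq_univ_of_forall fun y => ?_
  obtain ⟨s, hs, hs'⟩ := y.2.2.2
  refine Set.mem_iUnion.2 ⟨⟨Finset.univ.filter fun w => y.1 w ≠ 0,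
    K.mem_faces_of_subset hs (fun v hv => ?_) ?_⟩, fun w hw => by simpa using hw⟩
  · obtain ⟨w, hw, rfl⟩ := Finset.mem_map.1 hv
    exact hs' w (by simpa using hw)
  · rw [Finset.map_nonempty, Finset.filter_nonempty_iff]
    by_contra! h
    have := y.2.2.1
    rw [Finset.sum_eq_zero h] at this
    simp at this

/-- The polyhedron is a finite union of closed parts, each mapping into one closed simplex. There
the topology is that of coordinates, and the inclusion into the weak topology is continuous. -/
lemma polyhedron.continuous_toRealization :
    Continuous (polyhedron.toRealization : K.polyhedron W → K.Realization) := by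
  classical
  refine LocallyFinite.continuous (f := fun i : {i : Finset W //
    i.map (Function.Embedding.subtype _) ∈ K.faces} => K.polyhedronPart W i)
    (locallyFinite_of_finite _) iUnion_polyhedronPart (fun i => isClosed_polyhedronPart _)
    (fun i => ?_)
  rw [continuousOn_iff_continuous_domRestrict]
  let f : K.polyhedronPart W i → K.ClosedSimplex ((i : Finset W).map (Function.Embedding.subtype _)) :=
    fun y => ⟨polyhedron.toRealization y.1, fun v hv => by
      obtain ⟨w, rfl, hw⟩ := polyhedron.mem_of_toRealization_ne_zero (Finsupp.mem_support_iff.1 hv)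
      exact Finset.mem_map_of_mem _ (by by_contra h; exact hw (y.2 w h))⟩
  have hf : Continuous f := by
    refine continuous_induced_rng.2 (continuous_pi fun v => ?_)
    change Continuous fun y : K.polyhedronPart W i => (polyhedron.toRealization y.1).1 v
    simp only [polyhedron.toRealization_apply]
    split_ifs with h
    · exact (continuous_apply _).comp (continuous_subtype_val.comp continuous_subtype_val)
    · exact continuous_const
  exact (K.continuous_closedSimplex i.2).comp hf

lemma isCompact_polyhedron : IsCompact (K.polyhedron W) := by
  classical
  have : K.polyhedron W = ⋃ i : {i : Finset W // i.map (Function.Embedding.subtype _) ∈ K.faces},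
      stdSimplex ℝ W ∩ ⋂ w, ⋂ _ : w ∉ (i : Finset W), {y | y w = 0} := by
    ext y
    simp only [Set.mem_iUnion, Set.mem_inter_iff, Set.mem_iInter, Set.mem_ofPred_eq]
    constructor
    · intro hy
      obtain ⟨i, hi⟩ := Set.mem_iUnion.1 (iUnion_polyhedronPart (K := K) (W := W) ▸
        Set.mem_univ (⟨y, hy⟩ : K.polyhedron W))
      exact ⟨i, ⟨hy.1, hy.2.1⟩, hi⟩
    · rintro ⟨i, hy, hi⟩
      exact ⟨hy.1, hy.2, _, i.2, fun w hw => Finset.mem_map_of_mem _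
        (by by_contra h; exact hw (hi w h))⟩
  rw [this]
  refine isCompact_iUnion fun i => (isCompact_stdSimplex ℝ W).inter_right ?_
  exact isClosed_iInter fun w => isClosed_iInter fun _ =>
    isClosed_eq (continuous_apply w) continuous_const

variable (K W) in
/-- A simplicial approximation of a contraction of `|K|` on the part lying over `W`. -/
theorem exists_approximation [ContractibleSpace K.Realization] :
    ∃ δ > 0, ∃ φ : ℝ → (W → ℝ) → V, ∃ s₁ ∈ K.faces,
      (∀ y ∈ K.polyhedron W, ∀ t ∈ Set.Icc (0 : ℝ) 1, ∃ s ∈ K.faces,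
        ∀ x ∈ K.polyhedron W, ∀ t' ∈ Set.Icc (0 : ℝ) 1, dist x y < δ → dist t' t < δ →
          φ t' x ∈ s) ∧
      (∀ x ∈ K.polyhedron W, ∃ w : W, φ 0 x = w ∧ x w ≠ 0) ∧
      (∀ x ∈ K.polyhedron W, φ 1 x ∈ s₁) := by
  classical
  obtain ⟨x₀, ⟨H⟩⟩ := id_nullhomotopic K.Realization
  have : CompactSpace (K.polyhedron W) := isCompact_iff_compactSpace.1 isCompact_polyhedron
  let G : K.polyhedron W × unitInterval → K.Realization :=
    fun p => H (p.2, polyhedron.toRealization p.1)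
  have hG : Continuous G := H.continuous.comp
    (continuous_snd.prodMk (polyhedron.continuous_toRealization.comp continuous_fst))
  -- Take a Lebesgue number for the preimages of the open vertex stars under the homotopy; `ψ p` is
  -- then a vertex whose star contains the image of the δ-ball about `p`.
  obtain ⟨δ, hδ, hL⟩ := lebesgue_number_lemma_of_metric
    (s := (Set.univ : Set (K.polyhedron W × unitInterval)))
    (c := fun v : V => {p | 0 < (G p).1 v}) isCompact_univ
    (fun v => isOpen_lt continuous_const ((K.continuous_coord v).comp hG))
    (fun p _ => by
      obtain ⟨v, hv⟩ := (K.isRelLowerSet_faces (G p).2.1).1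
      exact Set.mem_iUnion.2 ⟨v, lt_of_le_of_ne ((G p).2.2.1 v)
        (Ne.symm (Finsupp.mem_support_iff.1 hv))⟩)
  choose ψ hψ using fun p => hL p (Set.mem_univ p)
  have hψ' : ∀ p q, dist p q < δ → ψ p ∈ (G q).1.support := fun p q h =>
    Finsupp.mem_support_iff.2 (ne_of_gt (hψ p (Metric.mem_ball'.2 h)))
  let v₀ : V := (K.isRelLowerSet_faces x₀.2.1).1.choose
  let φ : ℝ → (W → ℝ) → V := fun t x =>
    if h : x ∈ K.polyhedron W ∧ t ∈ Set.Icc (0 : ℝ) 1 then ψ (⟨x, h.1⟩, ⟨t, h.2⟩) else v₀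
  have hφ : ∀ t x (hx : x ∈ K.polyhedron W) (ht : t ∈ Set.Icc (0 : ℝ) 1),
      φ t x = ψ (⟨x, hx⟩, ⟨t, ht⟩) := fun t x hx ht => dif_pos ⟨hx, ht⟩
  refine ⟨δ, hδ, φ, x₀.1.support, x₀.2.1, fun y hy t ht => ?_, fun x hx => ?_, fun x hx => ?_⟩
  -- All these vertices have stars containing `G (y, t)`, so they lie in the support of that point,
  -- which is a simplex.
  · refine ⟨_, (G (⟨y, hy⟩, ⟨t, ht⟩)).2.1, fun x hx t' ht' h1 h2 => ?_⟩
    rw [hφ t' x hx ht']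
    exact hψ' _ _ (max_lt h1 h2)
  · have ht : (0 : ℝ) ∈ Set.Icc (0 : ℝ) 1 := by simp
    have := hψ' (⟨x, hx⟩, ⟨0, ht⟩) (⟨x, hx⟩, ⟨0, ht⟩) (by simpa using hδ)
    have e : G (⟨x, hx⟩, ⟨0, ht⟩) = polyhedron.toRealization ⟨x, hx⟩ := H.apply_zero _
    rw [e] at this
    obtain ⟨w, hw, hw'⟩ := polyhedron.mem_of_toRealization_ne_zero (Finsupp.mem_support_iff.1 this)
    exact ⟨w, by rw [hφ 0 x hx ht, hw], hw'⟩
  · have ht : (1 : ℝ) ∈ Set.Icc (0 : ℝ) 1 := by simp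
    have := hψ' (⟨x, hx⟩, ⟨1, ht⟩) (⟨x, hx⟩, ⟨1, ht⟩) (by simpa using hδ)
    have e : G (⟨x, hx⟩, ⟨1, ht⟩) = x₀ := H.apply_one _
    rw [e] at this
    rwa [hφ 1 x hx ht]

/-! ### The ordered chain complex of a contractible complex -/

variable (K) in
/-- The sequences of vertices spanning a simplex of `K`. -/
def lists : Set (List V) := {l | ∃ s ∈ K.faces, ∀ v ∈ l, v ∈ s}

lemma lists_sublist {l : List V} (hl : l ∈ K.lists) {m : List V} (hm : m.Sublist l) :
    m ∈ K.lists := by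
  obtain ⟨s, hs, h⟩ := hl
  exact ⟨s, hs, fun v hv => h v (hm.subset hv)⟩

variable (W) in
/-- The simplex spanned by a sequence of vertices in `W`, in barycentric coordinates. -/
def simplexOf (l : List V) : Set (W → ℝ) :=
  {y | (∀ w, 0 ≤ y w) ∧ ∑ w, y w = 1 ∧ ∀ w, y w ≠ 0 → (w : V) ∈ l}

lemma convex_simplexOf (l : List V) : Convex ℝ (simplexOf W l) := by
  intro x hx y hy a b ha hb hab
  refine ⟨fun w => ?_, ?_, fun w hw => ?_⟩
  · have := hx.1 w
    have := hy.1 w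
    simp only [Pi.add_apply, Pi.smul_apply, smul_eq_mul]
    positivity
  · simp only [Pi.add_apply, Pi.smul_apply, smul_eq_mul, Finset.sum_add_distrib, ← Finset.mul_sum,
      hx.2.1, hy.2.1, mul_one, hab]
  · by_contra h
    have h1 : x w = 0 := by by_contra h'; exact h (hx.2.2 w h')
    have h2 : y w = 0 := by by_contra h'; exact h (hy.2.2 w h')
    simp [h1, h2] at hw

lemma single_mem_simplexOf [DecidableEq V] {l : List V} {v : V} (hv : v ∈ l) (hW : v ∈ W) :
    (Pi.single ⟨v, hW⟩ 1 : W → ℝ) ∈ simplexOf W l := by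
  refine ⟨fun w => ?_, by simp, fun w hw => ?_⟩
  · by_cases h : w = ⟨v, hW⟩
    · subst h; simp
    · simp [h]
  · by_cases h : w = ⟨v, hW⟩
    · subst h; exact hv
    · simp [h] at hw

-- With S a subdivision into δ-small chains and φ the approximate contraction, φ₀S is homotopic to
-- the identity by simplex carriers, successive φ's are contiguous on small chains, and φ₁S lands in
-- one simplex, where every cycle bounds.
open ListChain in
theorem isAcyclic_lists (k : Type*) [CommRing k] [ContractibleSpace K.Realization] :
    IsAcyclic k K.lists := by
  classical
  intro c hc hz
  let W : Finset V := c.support.biUnion List.toFinset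
  obtain ⟨δ, hδ, φ, s₁, hs₁, hφ, hφ0, hφ1⟩ := K.exists_approximation W
  let P : Set (List V) := {l | l ∈ K.lists ∧ ∀ v ∈ l, v ∈ W}
  have hP : ∀ l ∈ P, ∀ m : List V, m.Sublist l → m ∈ P := fun l hl m hm =>
    ⟨lists_sublist hl.1 hm, fun v hv => hl.2 v (hm.subset hv)⟩
  have hcP : c ∈ on k P := (Finsupp.mem_supported _ _).2 fun l hl =>
    ⟨mem_of_mem_on hc hl, fun v hv => Finset.mem_biUnion.2 ⟨l, hl, List.mem_toFinset.2 hv⟩⟩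
  -- With ε = 1 and D = 0 this is a chain map. Any one carried by the simplices serves as a
  -- subdivision, as δ-small sequences in a simplex are acyclic.
  obtain ⟨S, hS0, hS⟩ := exists_lift (W := W → ℝ) P hP (fun l => on k (small (simplexOf W l) δ)) 1
    (fun _ => 0) (fun _ _ => Submodule.zero_mem _) (fun l _ => by
      rw [show (fun _ : List V => (0 : ListChain k (W → ℝ))) = 0 from rfl]; simp)
    (fun l hl m hm => Finsupp.supported_mono fun x hx =>
      ⟨fun y hy => ⟨(hx.1 y hy).1, (hx.1 y hy).2.1, fun w hw => hm.subset ((hx.1 y hy).2.2 w hw)⟩,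
        hx.2⟩)
    (fun l hl hne => by
      obtain ⟨v, hv⟩ := List.exists_mem_of_ne_nil l hne
      exact isAcyclic_small (convex_simplexOf l) (single_mem_simplexOf hv (hl.2 v hv)) hδ)
    (Finsupp.single [] 1) (single_mem_on (by simp [small]) 1) (by simp)
  have hpoly : ∀ l ∈ P, simplexOf W l ⊆ K.polyhedron W := by
    rintro l ⟨⟨s, hs, hls⟩, -⟩ y hy
    exact ⟨hy.1, hy.2.1, s, hs, fun w hw => hls _ (hy.2.2 w hw)⟩
  set B := (on k K.lists).map (bdry : ListChain k V →ₗ[k] ListChain k V) with hB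
  have hSc : ext S c ∈ on k (small (K.polyhedron W) δ) := by
    refine map_mem_of_single _ (fun l hl => ?_) hcP
    rw [ext, Finsupp.linearCombination_single, one_smul]
    exact on_mono (hS l hl).1 fun x hx => ⟨fun y hy => hpoly l hl (hx.1 y hy), hx.2⟩
  have hSz : bdry (ext S c) = 0 := by
    have := eq_of_single (bdry ∘ₗ ext S) (ext S ∘ₗ bdry)
      (fun l hl => by simpa using (hS l hl).2) hcP
    simpa [hz] using this
  -- `φ 0` sends a point to a vertex of its own support, so both chain maps send `l` to chains on
  -- the vertices of `l`.
  have h0 : push (φ 0) (ext S c) - c ∈ B := by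
    refine exists_bdry_eq_of_carrier (Q := K.lists) hP (fun l => {m | ∀ v ∈ m, v ∈ l})
      (fun l hl _ m hm => ?_) (push (φ 0) ∘ₗ ext S - LinearMap.id) (by simp [hS0])
      (fun l hl => ?_) (fun l hl => ?_) (fun l hl m hm x hx v hv => hm.subset (hx v hv))
      (fun l hl hne => ?_) hcP hz
    · obtain ⟨s, hs, h⟩ := hl.1
      exact ⟨s, hs, fun v hv => h v (hm v hv)⟩
    · simp [bdry_push, (hS l hl).2]
    · simp only [LinearMap.sub_apply, LinearMap.comp_apply, LinearMap.id_apply]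
      refine Submodule.sub_mem _ ?_ (single_mem_on (fun v hv => hv) 1)
      have hSl : ext S (Finsupp.single l (1 : k)) ∈ on k (small (simplexOf W l) δ) := by
        simpa using (hS l hl).1
      refine push_mem_on (R := {m | ∀ v ∈ m, v ∈ l}) (fun m hm v hv => ?_) hSl
      obtain ⟨y, hy, rfl⟩ := List.mem_map.1 hv
      obtain ⟨w, hw, hw'⟩ := hφ0 y (hpoly l hl (hm.1 y hy))
      rw [hw]
      exact (hm.1 y hy).2.2 w hw'
    · obtain ⟨v, hv⟩ := List.exists_mem_of_ne_nil l hne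
      exact isAcyclic_of_cone v fun m hm x hx => (List.mem_cons.1 hx).elim (fun h => h ▸ hv) (hm x)
  have h1 : push (φ 1) (ext S c) ∈ B := by
    have hmem : push (φ 1) (ext S c) ∈ on k {m : List V | ∀ v ∈ m, v ∈ s₁} :=
      push_mem_on (fun m hm v hv => by
        obtain ⟨y, hy, rfl⟩ := List.mem_map.1 hv
        exact hφ1 y (hm.1 y hy)) hSc
    obtain ⟨v, hv⟩ := (K.isRelLowerSet_faces hs₁).1
    obtain ⟨b, hb, hb'⟩ := isAcyclic_of_cone (k := k) (Q := {m : List V | ∀ v ∈ m, v ∈ s₁}) v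
      (fun m hm x hx => (List.mem_cons.1 hx).elim (fun h => h ▸ hv) (hm x)) _ hmem
      (by rw [bdry_push, hSz, map_zero])
    exact ⟨b, on_mono hb fun m hm => ⟨s₁, hs₁, hm⟩, hb'⟩
  obtain ⟨n, hn⟩ := exists_nat_one_div_lt hδ
  set η : ℝ := 1 / ((n : ℝ) + 1) with hη
  have hη0 : 0 ≤ η := by positivity
  have htel := Submodule.sub_mem_of_telescope B (fun i : ℕ => push (φ (i * η)) (ext S c)) (n + 1)
    (fun i hi => by
      have hi' : ((i + 1 : ℕ) : ℝ) * η ≤ 1 := by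
        rw [hη, mul_one_div, div_le_one (by positivity)]
        exact_mod_cast hi
      have hi0 : 0 ≤ (i : ℝ) * η := by positivity
      have hle : (i : ℝ) * η ≤ ((i + 1 : ℕ) : ℝ) * η := by push_cast; nlinarith
      refine exists_bdry_eq_of_contiguous (P := small (K.polyhedron W) δ) _ _
        (fun l hl m hm => small_sublist hl hm) (fun l hl m hm => ?_) hSc hSz
      cases l with
      | nil => exact ⟨s₁, hs₁, fun v hv => by simpa using hm v hv⟩
      | cons y l =>
        obtain ⟨s, hs, hs'⟩ := hφ y (hl.1 y (by simp)) (i * η) ⟨hi0, hle.trans hi'⟩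
        refine ⟨s, hs, fun v hv => ?_⟩
        obtain ⟨x, hx, rfl | rfl⟩ := hm v hv
        · exact hs' x (hl.1 x hx) _ ⟨hi0, hle.trans hi'⟩ (hl.2 x hx y (by simp)) (by simpa using hδ)
        · refine hs' x (hl.1 x hx) _ ⟨hi0.trans hle, hi'⟩ (hl.2 x hx y (by simp)) ?_
          have e : ((i + 1 : ℕ) : ℝ) * η - i * η = η := by push_cast; ring
          rwa [Real.dist_eq, e, abs_of_nonneg hη0])
  have e0 : ((0 : ℕ) : ℝ) * η = 0 := by simp
  have e1 : ((n + 1 : ℕ) : ℝ) * η = 1 := by rw [hη]; push_cast; field_simp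
  rw [e0, e1] at htel
  have : c ∈ B := by
    have := B.sub_mem (B.add_mem htel h1) h0
    simpa using this
  exact this

end AbstractSimplicialComplex

/-! ### Equivariant comparison of free acyclic complexes -/

namespace ListChain

variable {k : Type*} [CommRing k] {Γ : Type*} [Group Γ] {V W : Type*} [MulAction Γ V]
  [MulAction Γ W] {E : Type*} [AddCommGroup E] [Module k E]

/-- A set of sequences is a free acyclic complex: it is closed under passing to subsequences,
invariant and acyclic, and the action on the points is free. -/
structure IsFreeAcyclic (k Γ : Type*) [CommRing k] [Group Γ] {V : Type*} [MulAction Γ V]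
    (Q : Set (List V)) (γ : V → Γ) : Prop where
  sublist : ∀ l ∈ Q, ∀ m : List V, m.Sublist l → m ∈ Q
  map_smul : ∀ (g : Γ), ∀ l ∈ Q, l.map (g • ·) ∈ Q
  acyclic : IsAcyclic k Q
  nil_mem : [] ∈ Q
  smul : ∀ (g : Γ) v, γ (g • v) = g * γ v

/-- Freeness of the source and acyclicity of the target suffice; the carriers fix the length, so the
map preserves degree. -/
lemma IsFreeAcyclic.exists_chainMap {Q : Set (List V)} {R : Set (List W)} {γ : V → Γ}
    {γ' : W → Γ} (hQ : IsFreeAcyclic k Γ Q γ) (hR : IsFreeAcyclic k Γ R γ') :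
    ∃ α : List V → ListChain k W, α [] = Finsupp.single [] 1 ∧ ∀ l ∈ Q,
      α l ∈ on k {m | m ∈ R ∧ m.length = l.length} ∧ bdry (α l) = ext α (face k l) ∧
      ∀ g : Γ, α (l.map (g • ·)) = push (g • ·) (α l) := by
  obtain ⟨h, h0, h1⟩ := exists_equivariant_lift (k := k) γ hQ.smul Q hQ.sublist hQ.map_smul
    (fun l => on k {m : List W | m ∈ R ∧ m.length = l.length})
    (fun l => on k {m : List W | m ∈ R ∧ m.length + 1 = l.length})
    (fun g l _ c hc => by
      refine push_mem_on ?_ hc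
      exact fun m hm => ⟨hR.map_smul g m hm.1, by simp [hm.2]⟩)
    1 0 (fun _ _ => Submodule.zero_mem _) (fun _ _ _ => by simp) (fun _ _ => by simp)
    (fun l _ m _ hm => Finsupp.supported_mono fun x hx => ⟨hx.1, by rw [hx.2, hm]⟩)
    (fun l _ hne c hc hz => by
      obtain ⟨p, hp⟩ : ∃ p, l.length = p + 1 :=
        Nat.exists_eq_succ_of_ne_zero (by simpa using hne)
      rw [hp] at hc ⊢
      refine hR.acyclic.exists_ofLength (on_mono hc ?_) hz
      exact fun m hm => ⟨hm.1, by simpa using hm.2⟩)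
    (Finsupp.single [] 1) (single_mem_on (by exact ⟨hR.nil_mem, rfl⟩) 1) (by simp) (fun g => by simp)
  exact ⟨h, h0, fun l hl => ⟨(h1 l hl).1, by simpa using (h1 l hl).2.1, (h1 l hl).2.2⟩⟩

lemma IsFreeAcyclic.exists_homotopy {Q : Set (List V)} {γ : V → Γ}
    (hQ : IsFreeAcyclic k Γ Q γ) (D : List V → ListChain k V) (hD0 : D [] = 0)
    (hD : ∀ l ∈ Q, D l ∈ on k {m | m ∈ Q ∧ m.length = l.length} ∧ bdry (D l) = ext D (face k l) ∧
      ∀ g : Γ, D (l.map (g • ·)) = push (g • ·) (D l)) :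
    ∃ h : List V → ListChain k V, h [] = 0 ∧ ∀ l ∈ Q,
      h l ∈ on k {m | m ∈ Q ∧ m.length = l.length + 1} ∧
      bdry (h l) = D l - ext h (face k l) ∧
      ∀ g : Γ, h (l.map (g • ·)) = push (g • ·) (h l) := by
  obtain ⟨h, h0, h1⟩ := exists_equivariant_lift (k := k) γ hQ.smul Q hQ.sublist hQ.map_smul
    (fun l => on k {m : List V | m ∈ Q ∧ m.length = l.length + 1})
    (fun l => on k {m : List V | m ∈ Q ∧ m.length = l.length})
    (fun g l _ c hc => by
      refine push_mem_on ?_ hc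
      exact fun m hm => ⟨hQ.map_smul g m hm.1, by simp [hm.2]⟩)
    (-1) D (fun l hl => (hD l hl).1) (fun g l hl => (hD l hl).2.2 g)
    (fun l hl => by rw [(hD l hl).2.1]; simp)
    (fun l _ m _ hm => Finsupp.supported_mono fun x hx => ⟨hx.1, by rw [hx.2, hm]⟩)
    (fun l _ _ c hc hz => hQ.acyclic.exists_ofLength hc hz)
    0 (Submodule.zero_mem _) (by simp [hD0]) (fun g => by simp)
  exact ⟨h, h0, fun l hl => ⟨(h1 l hl).1, by simpa [sub_eq_add_neg] using (h1 l hl).2.1,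
    (h1 l hl).2.2⟩⟩

/-- Every equivariant `n`-cocycle on `Q` with values in `ρ` is a coboundary. The condition
`u [] = 0` removes the augmentation when `n = 0`. -/
def CohomologyVanishes (Q : Set (List V)) (ρ : Representation k Γ E) (n : ℕ) : Prop :=
  ∀ f : List V → E, (∀ l ∈ Q, l.length = n + 1 → ∀ g : Γ, f (l.map (g • ·)) = ρ g (f l)) →
    (∀ l ∈ Q, l.length = n + 2 → ext f (face k l) = 0) →
    ∃ u : List V → E, u [] = 0 ∧
      (∀ l ∈ Q, l.length = n → ∀ g : Γ, u (l.map (g • ·)) = ρ g (u l)) ∧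
      ∀ l ∈ Q, l.length = n + 1 → f l = ext u (face k l)

lemma ext_push {Q : Set (List V)} {f : List V → E} {g : Γ} {T : E →ₗ[k] E}
    (hf : ∀ l ∈ Q, f (l.map (g • ·)) = T (f l)) {c : ListChain k V} (hc : c ∈ on k Q) :
    ext f (push (g • ·) c) = T (ext f c) :=
  eq_of_single (ext f ∘ₗ push (g • ·)) (T ∘ₗ ext f) (fun l hl => by simp [hf l hl]) hc

lemma ext_bdry_eq_zero {Q : Set (List V)} {f : List V → E}
    (hf : ∀ l ∈ Q, ext f (face k l) = 0) {c : ListChain k V} (hc : c ∈ on k Q) :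
    ext f (bdry c) = 0 :=
  eq_of_single (ext f ∘ₗ bdry) 0 (fun l hl => by simp [hf l hl]) hc

lemma ext_ext (f : List W → E) (β : List V → ListChain k W) (c : ListChain k V) :
    ext f (ext β c) = ext (fun m => ext f (β m)) c := by
  have : ext f ∘ₗ ext β = ext (fun m => ext f (β m)) := by ext l : 2; simp
  exact congrArg (· c) this

lemma IsFreeAcyclic.face_mem {Q : Set (List V)} {γ : V → Γ} (hQ : IsFreeAcyclic k Γ Q γ)
    {l : List V} (hl : l ∈ Q) {n : ℕ} (hn : l.length = n + 1) :
    face k l ∈ on k {m | m ∈ Q ∧ m.length = n} :=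
  on_mono (face_mem_on l) fun m hm => ⟨hQ.sublist l hl m hm.1, by have := hm.2; omega⟩

/-- Vanishing of equivariant cohomology does not depend on the free acyclic complex. -/
theorem IsFreeAcyclic.cohomologyVanishes {Q : Set (List V)} {R : Set (List W)} {γ : V → Γ}
    {γ' : W → Γ} (hQ : IsFreeAcyclic k Γ Q γ) (hR : IsFreeAcyclic k Γ R γ')
    {ρ : Representation k Γ E} {n : ℕ} (h : CohomologyVanishes R ρ n) :
    CohomologyVanishes Q ρ n := by
  intro f hf hcoc
  obtain ⟨α, α0, hα⟩ := hQ.exists_chainMap hR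
  obtain ⟨β, β0, hβ⟩ := hR.exists_chainMap hQ
  have hβα : ∀ l ∈ Q, ext β (α l) ∈ on k {m | m ∈ Q ∧ m.length = l.length} := by
    refine fun l hl => map_mem_of_single _ (fun m hm => ?_) (hα l hl).1
    rw [Finsupp.linearCombination_single, one_smul]
    exact on_mono (hβ m hm.1).1 fun x hx => ⟨hx.1, hx.2.trans hm.2⟩
  -- s is an equivariant homotopy between βα and the identity: ∂s + s∂ = βα - 1.
  obtain ⟨s, s0, hs⟩ := hQ.exists_homotopy (fun l => ext β (α l) - Finsupp.single l 1)
    (by simp [α0, β0]) (fun l hl => ⟨Submodule.sub_mem _ (hβα l hl) (single_mem_on (by exact ⟨hl, rfl⟩) 1), by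
      have e1 : bdry (ext β (α l)) = ext β (bdry (α l)) :=
        eq_of_single (bdry ∘ₗ ext β) (ext β ∘ₗ bdry)
          (fun m hm => by simpa using (hβ m hm.1).2.1) (hα l hl).1
      have e2 : ext (fun l => ext β (α l) - Finsupp.single l (1 : k)) =
          ext β ∘ₗ ext α - LinearMap.id := by ext m : 2; simp
      rw [map_sub, e1, e2, (hα l hl).2.1, bdry_single_one]
      rfl, fun g => by
      have e3 : ext β (push (g • ·) (α l)) = push (g • ·) (ext β (α l)) :=
        eq_of_single (ext β ∘ₗ push (g • ·)) (push (g • ·) ∘ₗ ext β)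
          (fun m hm => by simpa using (hβ m hm.1).2.2 g) (hα l hl).1
      rw [(hα l hl).2.2 g, map_sub, e3, push_single]⟩)
  obtain ⟨u, u0, hu, hfu⟩ := h (fun m => ext f (β m))
    (fun m hm hn g => by
      rw [(hβ m hm).2.2 g]
      exact ext_push (fun l hl => hf l hl.1 (hl.2.trans hn) g) (hβ m hm).1)
    (fun m hm hn => by
      rw [← ext_ext, ← (hβ m hm).2.1]
      exact ext_bdry_eq_zero (fun l hl => hcoc l hl.1 (hl.2.trans hn)) (hβ m hm).1)
  -- Apply f to βα - 1 = ∂s + s∂. The cocycle condition kills f∂s, and fβ = u∂ gives f = (uα - fs)∂.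
  refine ⟨fun l => ext u (α l) - ext f (s l), by simp [α0, s0, u0], fun l hl hn g => ?_,
    fun l hl hn => ?_⟩
  · beta_reduce
    rw [(hα l hl).2.2 g, (hs l hl).2.2 g, map_sub,
      ext_push (T := ρ g) (fun m hm => hu m hm.1 (hm.2.trans hn) g) (hα l hl).1,
      ext_push (T := ρ g) (fun m hm => hf m hm.1 (by rw [hm.2, hn]) g) (hs l hl).1]
  · have e1 : ext f (ext β (α l)) = ext u (ext α (face k l)) := by
      rw [ext_ext, ← (hα l hl).2.1]
      exact eq_of_single _ (ext u ∘ₗ bdry)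
        (fun m hm => by simpa using hfu m hm.1 (hm.2.trans hn)) (hα l hl).1
    have e2 : ext f (bdry (s l)) = 0 :=
      ext_bdry_eq_zero (fun m hm => hcoc m hm.1 (by rw [hm.2, hn])) (hs l hl).1
    have e3 : ext (fun l => ext u (α l) - ext f (s l)) =
        ext u ∘ₗ ext α - ext f ∘ₗ ext s := by ext m : 2; simp
    rw [(hs l hl).2.1, map_sub, map_sub, e1, Finsupp.linearCombination_single, one_smul] at e2
    rw [e3, LinearMap.sub_apply, LinearMap.comp_apply, LinearMap.comp_apply]
    rw [sub_sub, sub_eq_zero] at e2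
    rw [e2, add_sub_cancel_right]

/-- The complex of all sequences in a group. -/
lemma isFreeAcyclic_univ : IsFreeAcyclic k Γ (Set.univ : Set (List Γ)) id where
  sublist _ _ _ _ := Set.mem_univ _
  map_smul _ _ _ := Set.mem_univ _
  acyclic := isAcyclic_of_cone 1 fun _ _ => Set.mem_univ _
  nil_mem := Set.mem_univ _
  smul _ _ := rfl

end ListChain

/-! ### Eilenberg–MacLane complexes as free acyclic complexes -/

lemma mem_vertexTranslate {Γ V : Type*} [Group Γ] [MulAction Γ V] {g : Γ} {s : Finset V} {v : V} :
    v ∈ vertexTranslate g s ↔ ∃ w ∈ s, g • w = v := by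
  simp only [vertexTranslate, Finset.mem_map]
  rfl

/-- A free action is equivariantly trivialized by a choice of orbit representatives. -/
lemma MulAction.exists_equivariant {Γ V : Type*} [Group Γ] [MulAction Γ V]
    (h : ∀ (g : Γ) (v : V), g • v = v → g = 1) :
    ∃ γ : V → Γ, ∀ (g : Γ) v, γ (g • v) = g * γ v := by
  let r : V → V := fun v => (Quotient.mk (MulAction.orbitRel Γ V) v).out
  have hr : ∀ v, ∃ g : Γ, g • r v = v := fun v => by
    have : (MulAction.orbitRel Γ V).r (r v) v := Quotient.mk_out (s := MulAction.orbitRel Γ V) v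
    obtain ⟨g, hg⟩ := MulAction.mem_orbit_iff.1 ((MulAction.orbitRel Γ V).symm this)
    exact ⟨g, hg⟩
  choose γ hγ using hr
  refine ⟨γ, fun g v => ?_⟩
  have e : r (g • v) = r v := by
    have : (Quotient.mk (MulAction.orbitRel Γ V) (g • v)) = Quotient.mk _ v :=
      Quotient.sound (MulAction.mem_orbit v g)
    simp only [r, this]
  have h1 := hγ (g • v)
  rw [e] at h1
  -- Both `γ (g • v)` and `g * γ v` carry the representative to `g • v`, so their quotient fixes it.
  have h2 : ((γ v)⁻¹ * g⁻¹ * γ (g • v)) • r v = r v := by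
    rw [mul_smul, h1, mul_smul, inv_smul_smul, inv_smul_eq_iff, hγ]
  have h3 := h _ _ h2
  rw [mul_assoc, inv_mul_eq_one, eq_inv_mul_iff_mul_eq] at h3
  exact h3.symm

lemma IsEilenbergMacLaneComplex.isFreeAcyclic (k : Type*) [CommRing k] {Γ V : Type*} [Group Γ]
    [MulAction Γ V] {K : AbstractSimplicialComplex V} {n : ℕ}
    (hK : IsEilenbergMacLaneComplex Γ K n) :
    ∃ γ : V → Γ, ListChain.IsFreeAcyclic k Γ K.lists γ := by
  have := hK.contractible
  -- Every element of `V` is a vertex of `K`, so freeness on simplices, applied to `{v}`, makes the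
  -- action on `V` free.
  obtain ⟨γ, hγ⟩ := MulAction.exists_equivariant (Γ := Γ) (V := V) fun g v hv =>
    hK.free g {v} (K.singleton_mem v) (by
      ext w
      rw [mem_vertexTranslate]
      simp [hv, eq_comm])
  refine ⟨γ, fun l hl m hm => AbstractSimplicialComplex.lists_sublist hl hm, fun g l hl => ?_,
    AbstractSimplicialComplex.isAcyclic_lists k, ?_, hγ⟩
  · obtain ⟨s, hs, h⟩ := hl
    refine ⟨vertexTranslate g s, hK.simplicial g s hs, fun v hv => ?_⟩
    obtain ⟨w, hw, rfl⟩ := List.mem_map.1 hv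
    exact mem_vertexTranslate.2 ⟨w, h w hw, rfl⟩
  · obtain ⟨x⟩ := (inferInstance : Nonempty K.Realization)
    exact ⟨_, x.2.1, by simp⟩

/-! ### Inhomogeneous and homogeneous cochains -/

namespace ListChain

section

variable {k : Type*} [CommRing k] {V : Type*}

lemma face_ofFn {n : ℕ} (y : Fin (n + 1) → V) :
    face k (List.ofFn y) =
      ∑ i : Fin (n + 1), Finsupp.single (List.ofFn (y ∘ i.succAbove)) ((-1 : k) ^ (i : ℕ)) := by
  induction n with
  | zero => simp [List.ofFn_succ, face_cons]
  | succ n ih =>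
    rw [List.ofFn_succ, face_cons, ih, map_sum, Fin.sum_univ_succ (n := n + 1), sub_eq_add_neg,
      ← Finset.sum_neg_distrib]
    congr 1
    · simp [Function.comp_def]
    · refine Finset.sum_congr rfl fun i _ => ?_
      rw [cone_single, ← Finsupp.single_neg, Fin.val_succ, pow_succ, mul_neg_one]
      congr 1
      rw [List.ofFn_succ]
      simp [Function.comp_def]

variable {Γ : Type*} [Group Γ] {E : Type*} [AddCommGroup E] [Module k E]

/-- The sequence of partial products of a finite sequence of group elements, starting at `1`. -/
def homogenize {n : ℕ} (x : Fin n → Γ) : List Γ := List.ofFn (Fin.partialProd x)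

@[simp] lemma length_homogenize {n : ℕ} (x : Fin n → Γ) : (homogenize x).length = n + 1 := by
  simp [homogenize]

lemma exists_homogenize {n : ℕ} {l : List Γ} (hl : l.length = n + 1) :
    ∃ (g : Γ) (x : Fin n → Γ), l = (homogenize x).map (g • ·) := by
  let y : Fin (n + 1) → Γ := fun i => l.get (i.cast hl.symm)
  refine ⟨y 0, fun i => (y i.castSucc)⁻¹ * y i.succ, ?_⟩
  rw [homogenize, List.map_ofFn]
  have := Fin.partialProd_left_inv y
  rw [show ((y 0 • ·) ∘ Fin.partialProd fun i : Fin n => (y i.castSucc)⁻¹ * y i.succ) = y from this]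
  refine List.ext_get (by simp [hl]) fun i h1 h2 => ?_
  rw [List.get_ofFn]
  rfl

/-- Every inhomogeneous cochain is the restriction of an equivariant function. -/
lemma exists_homogeneous (ρ : Representation k Γ E) {n : ℕ} (f : (Fin n → Γ) → E) :
    ∃ F : List Γ → E, F [] = 0 ∧
      (∀ l : List Γ, l.length = n + 1 → ∀ g : Γ, F (l.map (g • ·)) = ρ g (F l)) ∧
      ∀ x, F (homogenize x) = f x := by
  classical
  let q : ∀ l : List Γ, l.length = n + 1 → Fin (n + 1) → Γ := fun l hl i => l.get (i.cast hl.symm)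
  refine ⟨fun l => if hl : l.length = n + 1 then
    ρ (q l hl 0) (f fun i => (q l hl i.castSucc)⁻¹ * q l hl i.succ) else 0, by simp,
    fun l hl g => ?_, fun x => ?_⟩
  · have hl' : (l.map (g • ·)).length = n + 1 := by simpa using hl
    have e : ∀ i, q _ hl' i = g * q l hl i := fun i => by simp [q]
    beta_reduce
    rw [dif_pos hl', dif_pos hl]
    simp only [e, map_mul, mul_inv_rev, mul_assoc, inv_mul_cancel_left]
    rfl
  · have hl : (homogenize x).length = n + 1 := by simp
    have e : ∀ i, q _ hl i = Fin.partialProd x i := fun i => by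
      simp only [q, homogenize]
      rw [List.get_ofFn]
      rfl
    beta_reduce
    rw [dif_pos hl]
    simp only [e, Fin.partialProd_right_inv]
    simp

end

section

variable {k Γ : Type u} [CommRing k] [Group Γ] (A : Rep.{u} k Γ)

/-- Deleting the initial 1 from the partial products leaves a translate by the first group element,
which gives the term with `ρ`. Deleting a later entry contracts two adjacent factors or drops the
last one. -/
lemma ext_face_homogenize {n : ℕ} {F : List Γ → A}
    (hF : ∀ l : List Γ, l.length = n + 1 → ∀ g : Γ, F (l.map (g • ·)) = A.ρ g (F l))
    (x : Fin (n + 1) → Γ) :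
    ext F (face k (homogenize x)) =
      (inhomogeneousCochains.d A n).hom (fun y => F (homogenize y)) x := by
  rw [inhomogeneousCochains.d_hom_apply, homogenize, face_ofFn, Fin.sum_univ_succ, map_add, map_sum]
  congr 1
  · simp only [Fin.val_zero, pow_zero, Finsupp.linearCombination_single, one_smul]
    rw [← hF _ (by simp), homogenize, List.map_ofFn]
    congr 2
    ext i
    simp [Fin.partialProd_succ', Fin.tail_def]
  · refine Finset.sum_congr rfl fun j _ => ?_
    rw [Finsupp.linearCombination_single, homogenize, Fin.partialProd_contractNth, Fin.val_succ]

/-- No differential enters degree 0, so there vanishing means that the kernel is zero. -/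
lemma subsingleton_groupCohomology_iff (n : ℕ) :
    Subsingleton (groupCohomology A n) ↔
      ∀ f : (Fin n → Γ) → A, (inhomogeneousCochains.d A n).hom f = 0 →
        match n with
        | 0 => f = 0
        | m + 1 => ∃ u : (Fin m → Γ) → A, (inhomogeneousCochains.d A m).hom u = f := by
  rw [← ModuleCat.isZero_iff_subsingleton, groupCohomology,
    ← HomologicalComplex.exactAt_iff_isZero_homology]
  cases n with
  | zero =>
    rw [HomologicalComplex.exactAt_iff' _ 0 0 1 (by simp) (by simp),
      CategoryTheory.ShortComplex.moduleCat_exact_iff]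
    have h0 : (groupCohomology.inhomogeneousCochains A).d 0 0 = 0 :=
      HomologicalComplex.shape _ _ _ (by simp)
    have h1 := groupCohomology.inhomogeneousCochains.d_def A 0
    constructor
    · intro h f hf
      obtain ⟨u, hu⟩ := h f (by
        change ((groupCohomology.inhomogeneousCochains A).d 0 1).hom f = 0
        rw [h1]; exact hf)
      change ((groupCohomology.inhomogeneousCochains A).d 0 0).hom u = f at hu
      rw [h0] at hu
      exact hu.symm
    · intro h f hf
      change ((groupCohomology.inhomogeneousCochains A).d 0 1).hom f = 0 at hf
      rw [h1] at hf
      exact ⟨0, (map_zero _).trans (h f hf).symm⟩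
  | succ m =>
    rw [HomologicalComplex.exactAt_iff' _ m (m + 1) (m + 2) (by simp) (by simp),
      CategoryTheory.ShortComplex.moduleCat_exact_iff]
    have h0 := groupCohomology.inhomogeneousCochains.d_def A m
    have h1 := groupCohomology.inhomogeneousCochains.d_def A (m + 1)
    constructor
    · intro h f hf
      obtain ⟨u, hu⟩ := h f (by
        change ((groupCohomology.inhomogeneousCochains A).d (m + 1) (m + 2)).hom f = 0
        rw [h1]; exact hf)
      change ((groupCohomology.inhomogeneousCochains A).d m (m + 1)).hom u = f at hu
      rw [h0] at hu
      exact ⟨u, hu⟩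
    · intro h f hf
      change ((groupCohomology.inhomogeneousCochains A).d (m + 1) (m + 2)).hom f = 0 at hf
      rw [h1] at hf
      obtain ⟨u, hu⟩ := h f hf
      refine ⟨u, ?_⟩
      change ((groupCohomology.inhomogeneousCochains A).d m (m + 1)).hom u = f
      rw [h0]; exact hu

/-- Every nonempty sequence is a translate of a homogenized one, so equivariant functions correspond
to inhomogeneous cochains and the differentials match. -/
theorem subsingleton_groupCohomology_iff_cohomologyVanishes (n : ℕ) :
    Subsingleton (groupCohomology A n) ↔
      CohomologyVanishes (Set.univ : Set (List Γ)) A.ρ n := by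
  rw [subsingleton_groupCohomology_iff]
  have hpush : ∀ {n : ℕ} {F : List Γ → A},
      (∀ l : List Γ, l.length = n → ∀ g : Γ, F (l.map (g • ·)) = A.ρ g (F l)) →
      ∀ l : List Γ, l.length = n + 1 → ∀ g : Γ,
        ext F (face k (l.map (g • ·))) = A.ρ g (ext F (face k l)) := by
    intro n F hF l hl g
    rw [face_map]
    exact ext_push (fun m hm => hF m hm.2 g) (isFreeAcyclic_univ.face_mem (Set.mem_univ l) hl)
  constructor
  · intro h F hF hcoc
    have hF' := fun l hl => hF l (Set.mem_univ l) hl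
    have h1 := h (fun y => F (homogenize y)) (by
      ext x
      rw [← ext_face_homogenize A hF']
      exact hcoc _ (Set.mem_univ _) (by simp))
    cases n with
    | zero =>
      refine ⟨0, rfl, fun _ _ _ _ => by simp, fun l _ hl => ?_⟩
      obtain ⟨g, x, rfl⟩ := exists_homogenize hl
      have h2 : F (homogenize x) = 0 := congrFun h1 x
      rw [hF' _ (by simp), h2]
      simp
    | succ m =>
      obtain ⟨u, hu⟩ := h1
      obtain ⟨U, hU0, hU, hUu⟩ := exists_homogeneous A.ρ u
      refine ⟨U, hU0, fun l _ hl => hU l hl, fun l _ hl => ?_⟩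
      obtain ⟨g, x, rfl⟩ := exists_homogenize hl
      rw [hF' _ (by simp), hpush hU _ (by simp), ext_face_homogenize A hU, funext hUu]
      exact congrArg _ (congrFun hu x).symm
  · intro h f hf
    obtain ⟨F, -, hF, hFf⟩ := exists_homogeneous A.ρ f
    obtain ⟨U, hU0, hU, hFU⟩ := h F (fun l _ hl => hF l hl) (fun l _ hl => by
      obtain ⟨g, x, rfl⟩ := exists_homogenize hl
      rw [hpush hF _ (by simp), ext_face_homogenize A hF, funext hFf, hf]
      exact map_zero _)
    cases n with
    -- The only face of a one-term sequence is empty, where `U` is zero, so the cocycle itself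
    -- vanishes.
    | zero =>
      ext x
      have := hFU (homogenize x) (Set.mem_univ _) (by simp)
      rw [hFf] at this
      rw [this, homogenize, face_ofFn]
      simp [hU0]
    | succ m =>
      refine ⟨fun x => U (homogenize x), ?_⟩
      ext x
      rw [← ext_face_homogenize A (fun l hl => hU l (Set.mem_univ _) hl), ← hFf]
      exact (hFU (homogenize x) (Set.mem_univ _) (by simp)).symm

end

end ListChain

/-! ### Orbit representatives and coboundary operators -/

/-- A map into a finite product is the sum of its components followed by coordinate inclusions, and
composition is continuous in operator norm. -/
lemma tendsto_clm_pi {𝕜 X Y ι κ : Type*} [NontriviallyNormedField 𝕜] [Fintype κ]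
    [NormedAddCommGroup X] [NormedSpace 𝕜 X] [NormedAddCommGroup Y] [NormedSpace 𝕜 Y]
    {𝓕 : Filter ι} {T : ι → κ → X →L[𝕜] Y} {T₀ : κ → X →L[𝕜] Y}
    (h : ∀ j, Filter.Tendsto (fun i => T i j) 𝓕 (nhds (T₀ j))) :
    Filter.Tendsto (fun i => ContinuousLinearMap.pi (T i)) 𝓕
      (nhds (ContinuousLinearMap.pi T₀)) := by
  classical
  have e : ∀ S : κ → X →L[𝕜] Y, ContinuousLinearMap.pi S =
      ∑ j, (ContinuousLinearMap.single 𝕜 (fun _ : κ => Y) j).comp (S j) := by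
    intro S
    ext x j
    simp [Finset.sum_apply, Pi.single_apply]
  simp only [e]
  refine tendsto_finsetSum _ fun j _ => ?_
  have hc : Continuous fun R : X →L[𝕜] Y =>
      (ContinuousLinearMap.single 𝕜 (fun _ : κ => Y) j).comp R :=
    continuous_const.clm_comp continuous_id
  exact (hc.tendsto _).comp (h j)

namespace ListChain

section

variable {Γ : Type*} [Group Γ] {V : Type*} [MulAction Γ V]

/-- The value of `γ` on the first entry. -/
def headValue (γ : V → Γ) : List V → Γ
  | [] => 1
  | v :: _ => γ v

/-- The representative of the orbit of a sequence on whose first entry `γ` takes the value `1`. -/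
def normalForm (γ : V → Γ) (l : List V) : List V := l.map ((headValue γ l)⁻¹ • ·)

lemma map_smul_map_smul (g g' : Γ) (l : List V) :
    (l.map (g • ·)).map (g' • ·) = l.map ((g' * g) • ·) := by
  simp [mul_smul]

lemma map_normalForm (γ : V → Γ) (l : List V) :
    (normalForm γ l).map (headValue γ l • ·) = l := by
  rw [normalForm, map_smul_map_smul]
  simp

@[simp] lemma length_normalForm (γ : V → Γ) (l : List V) :
    (normalForm γ l).length = l.length := by simp [normalForm]

variable {γ : V → Γ} (hγ : ∀ (g : Γ) v, γ (g • v) = g * γ v)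

include hγ

lemma headValue_map {l : List V} (hl : l ≠ []) (g : Γ) :
    headValue γ (l.map (g • ·)) = g * headValue γ l := by
  cases l with
  | nil => exact (hl rfl).elim
  | cons v t => exact hγ g v

lemma normalForm_map (l : List V) (g : Γ) : normalForm γ (l.map (g • ·)) = normalForm γ l := by
  by_cases hl : l = []
  · simp [hl]
  · rw [normalForm, headValue_map hγ hl, map_smul_map_smul]
    simp [normalForm]

lemma normalForm_normalForm (l : List V) : normalForm γ (normalForm γ l) = normalForm γ l :=
  normalForm_map hγ l _

lemma headValue_normalForm (l : List V) : headValue γ (normalForm γ l) = 1 := by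
  by_cases hl : l = []
  · simp [hl, normalForm, headValue]
  · rw [normalForm, headValue_map hγ hl, inv_mul_cancel]

omit hγ

/-- The orbit representatives of the nonempty sequences of length `m` in `Q`. -/
def reps (Q : Set (List V)) (γ : V → Γ) (m : ℕ) : Set (List V) :=
  normalForm γ '' {l | l ∈ Q ∧ l ≠ [] ∧ l.length = m}

lemma normalForm_mem_reps {Q : Set (List V)} {m : ℕ} {l : List V} (hl : l ∈ Q) (hne : l ≠ [])
    (hm : l.length = m) : normalForm γ l ∈ reps Q γ m := ⟨l, ⟨hl, hne, hm⟩, rfl⟩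

end

section

variable {𝕜 Γ V E : Type*} [RCLike 𝕜] [Group Γ] [MulAction Γ V]
  [NormedAddCommGroup E] [NormedSpace 𝕜 E] {Q : Set (List V)} {γ : V → Γ}

open Classical in
/-- The equivariant function with given values on the orbit representatives. -/
noncomputable def equivariantExt (ρ : BanachRep 𝕜 Γ E) {m : ℕ} (f : reps Q γ m → E)
    (l : List V) : E :=
  if h : normalForm γ l ∈ reps Q γ m then
    ((ρ (headValue γ l) : (E →L[𝕜] E)ˣ) : E →L[𝕜] E) (f ⟨_, h⟩) else 0

open Classical in
/-- The coboundary operator in terms of the values on orbit representatives. -/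
noncomputable def coboundary (Q : Set (List V)) (γ : V → Γ) (ρ : BanachRep 𝕜 Γ E) (m : ℕ) :
    (reps Q γ m → E) →L[𝕜] (reps Q γ (m + 1) → E) :=
  ContinuousLinearMap.pi fun τ => ∑ σ ∈ (face 𝕜 τ.1).support, face 𝕜 τ.1 σ •
    -- For faces of a representative in a free acyclic `Q`, only the empty sequence falls into the
    -- zero branch; this removes the augmentation.
    if h : normalForm γ σ ∈ reps Q γ m then
      ((ρ (headValue γ σ) : (E →L[𝕜] E)ˣ) : E →L[𝕜] E).comp (ContinuousLinearMap.proj ⟨_, h⟩)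
    else 0

lemma coboundary_apply (ρ : BanachRep 𝕜 Γ E) {m : ℕ} (f : reps Q γ m → E)
    (τ : reps Q γ (m + 1)) :
    coboundary Q γ ρ m f τ = ext (equivariantExt ρ f) (face 𝕜 τ.1) := by
  simp only [coboundary, ContinuousLinearMap.pi_apply, sum_apply, ext,
    Finsupp.linearCombination_apply, Finsupp.sum]
  refine Finset.sum_congr rfl fun σ _ => ?_
  rw [smul_apply, equivariantExt]
  split_ifs <;> rfl

lemma not_nil_mem_reps {m : ℕ} : [] ∉ reps Q γ m := by
  rintro ⟨l, hl, h⟩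
  exact hl.2.1 (by simpa [normalForm] using h)

lemma equivariantExt_nil (ρ : BanachRep 𝕜 Γ E) {m : ℕ} (f : reps Q γ m → E) :
    equivariantExt ρ f [] = 0 := dif_neg not_nil_mem_reps

variable (hQ : IsFreeAcyclic 𝕜 Γ Q γ)
include hQ

lemma reps_subset {m : ℕ} {l : List V} (hl : l ∈ reps Q γ m) : l ∈ Q ∧ l ≠ [] ∧ l.length = m := by
  obtain ⟨l, ⟨h1, h2, h3⟩, rfl⟩ := hl
  exact ⟨hQ.map_smul _ _ h1, by simpa [normalForm] using h2, by simpa using h3⟩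

lemma equivariantExt_map (ρ : BanachRep 𝕜 Γ E) {m : ℕ} (f : reps Q γ m → E) (l : List V) (g : Γ) :
    equivariantExt ρ f (l.map (g • ·)) = ρ.toRepresentation g (equivariantExt ρ f l) := by
  by_cases hne : l = []
  · rw [hne, List.map_nil, equivariantExt_nil, map_zero]
  · by_cases h : normalForm γ l ∈ reps Q γ m
    · have h' : normalForm γ (l.map (g • ·)) ∈ reps Q γ m := by rwa [normalForm_map hQ.smul]
      rw [equivariantExt, equivariantExt, dif_pos h', dif_pos h]
      simp only [normalForm_map hQ.smul, headValue_map hQ.smul hne, map_mul]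
      rfl
    · have h' : normalForm γ (l.map (g • ·)) ∉ reps Q γ m := by rwa [normalForm_map hQ.smul]
      rw [equivariantExt, equivariantExt, dif_neg h', dif_neg h, map_zero]

lemma equivariantExt_of_mem (ρ : BanachRep 𝕜 Γ E) {m : ℕ} (f : reps Q γ m → E)
    (τ : reps Q γ m) : equivariantExt ρ f τ.1 = f τ := by
  obtain ⟨_, l, hl, rfl⟩ := τ
  rw [equivariantExt, dif_pos (by rw [normalForm_normalForm hQ.smul]; exact ⟨l, hl, rfl⟩),
    headValue_normalForm hQ.smul, map_one]
  simp only [normalForm_normalForm hQ.smul]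
  rfl

lemma eq_equivariantExt (ρ : BanachRep 𝕜 Γ E) {m : ℕ} {F : List V → E}
    (hF : ∀ l ∈ Q, l.length = m → ∀ g : Γ, F (l.map (g • ·)) = ρ.toRepresentation g (F l))
    (f : reps Q γ m → E) (hf : ∀ τ, F τ.1 = f τ) {l : List V} (hl : l ∈ Q) (hm : l.length = m)
    (hne : l ≠ []) : F l = equivariantExt ρ f l := by
  have hl' : normalForm γ l ∈ Q := hQ.map_smul _ _ hl
  rw [← map_normalForm γ l, equivariantExt_map hQ, hF _ hl' (by simpa using hm)]
  congr 1
  rw [equivariantExt_of_mem hQ ρ f ⟨_, normalForm_mem_reps hl hne hm⟩, ← hf]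

/-- Both sides are equivariant in `l`, so agreement on representatives, where it is the definition
of `coboundary`, is enough. -/
lemma equivariantExt_coboundary (ρ : BanachRep 𝕜 Γ E) {m : ℕ} (f : reps Q γ m → E) {l : List V}
    (hl : l ∈ Q) (hm : l.length = m + 1) :
    equivariantExt ρ (coboundary Q γ ρ m f) l = ext (equivariantExt ρ f) (face 𝕜 l) := by
  refine (eq_equivariantExt hQ ρ (F := fun l => ext (equivariantExt ρ f) (face 𝕜 l))
    (fun l hl hm g => ?_) _ (fun τ => (coboundary_apply ρ f τ).symm) hl hm ?_).symm
  · rw [face_map]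
    exact ext_push (fun m _ => equivariantExt_map hQ ρ f m g) (hQ.face_mem hl hm)
  · rintro rfl
    simp at hm

lemma coboundary_coboundary (ρ : BanachRep 𝕜 Γ E) {m : ℕ} (f : reps Q γ m → E) :
    coboundary Q γ ρ (m + 1) (coboundary Q γ ρ m f) = 0 := by
  ext τ
  obtain ⟨h1, -, h2⟩ := reps_subset hQ τ.2
  rw [coboundary_apply]
  have := eq_of_single (ext (equivariantExt ρ (coboundary Q γ ρ m f)))
    (ext (equivariantExt ρ f) ∘ₗ bdry)
    (fun l hl => by simpa using equivariantExt_coboundary hQ ρ f hl.1 hl.2) (hQ.face_mem h1 h2)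
  rw [this, LinearMap.comp_apply, bdry_face, map_zero]
  rfl

theorem cohomologyVanishes_iff_coboundary (ρ : BanachRep 𝕜 Γ E) (n : ℕ) :
    CohomologyVanishes Q ρ.toRepresentation n ↔
      ∀ f, coboundary Q γ ρ (n + 1) f = 0 → ∃ u, coboundary Q γ ρ n u = f := by
  constructor
  · intro h f hf
    obtain ⟨U, hU0, hU, hfU⟩ := h (equivariantExt ρ f) (fun l _ _ g => equivariantExt_map hQ ρ f l g)
      (fun l hl hn => by
        rw [← equivariantExt_coboundary hQ ρ f hl hn, hf]
        simp [equivariantExt])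
    refine ⟨fun τ => U τ.1, ?_⟩
    ext τ
    obtain ⟨h1, -, h2⟩ := reps_subset hQ τ.2
    rw [coboundary_apply, ← equivariantExt_of_mem hQ ρ f τ, hfU _ h1 h2]
    refine ext_congr (fun l hl => ?_) (hQ.face_mem h1 h2)
    by_cases hne : l = []
    · rw [hne, equivariantExt_nil, hU0]
    · exact (eq_equivariantExt hQ ρ hU _ (fun _ => rfl) hl.1 hl.2 hne).symm
  · intro h F hF hcoc
    have hne : ∀ {l : List V} {m : ℕ}, l.length = m + 1 → l ≠ [] := by rintro l m hl rfl; simp at hl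
    have hFe : ∀ l ∈ Q, l.length = n + 1 →
        F l = equivariantExt ρ (fun τ : reps Q γ (n + 1) => F τ.1) l := fun l hl hn =>
      eq_equivariantExt hQ ρ hF _ (fun _ => rfl) hl hn (hne hn)
    obtain ⟨u, hu⟩ := h (fun τ => F τ.1) (by
      ext τ
      obtain ⟨h1, -, h2⟩ := reps_subset hQ τ.2
      rw [coboundary_apply, ← ext_congr (fun l hl => hFe l hl.1 hl.2) (hQ.face_mem h1 h2)]
      exact hcoc _ h1 h2)
    refine ⟨equivariantExt ρ u, equivariantExt_nil ρ u,
      fun l _ _ g => equivariantExt_map hQ ρ u l g, fun l hl hn => ?_⟩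
    rw [hFe l hl hn, ← hu, equivariantExt_coboundary hQ ρ u hl hn]

omit hQ

/-- Each component is a finite sum of operators ρ(g) composed with projections, and the elements g
and the coefficients do not depend on ρ. -/
lemma tendsto_coboundary {m : ℕ} [Fintype (reps Q γ (m + 1))] [Fintype (reps Q γ m)]
    {𝓕 : Filter (BanachRep 𝕜 Γ E)} {π : BanachRep 𝕜 Γ E}
    (h : ∀ g : Γ, Filter.Tendsto (fun ρ : BanachRep 𝕜 Γ E => ((ρ g : (E →L[𝕜] E)ˣ) : E →L[𝕜] E)) 𝓕
      (nhds ((π g : (E →L[𝕜] E)ˣ) : E →L[𝕜] E))) :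
    Filter.Tendsto (fun ρ => coboundary Q γ ρ m) 𝓕 (nhds (coboundary Q γ π m)) := by
  classical
  refine tendsto_clm_pi fun τ => tendsto_finsetSum _ fun σ _ => Filter.Tendsto.const_smul ?_ _
  split_ifs with hσ
  · have hc : Continuous fun T : E →L[𝕜] E =>
        T.comp (ContinuousLinearMap.proj (R := 𝕜) (φ := fun _ : reps Q γ m => E) ⟨_, hσ⟩) :=
      continuous_id.clm_comp continuous_const
    exact (hc.tendsto _).comp (h _)
  · exact tendsto_const_nhds

end

end ListChain

/-! ### Stability of exactness -/

/-- The rank is lower semicontinuous. -/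
lemma eventually_finrank_range_le {𝕜 X Y ι : Type*} [NontriviallyNormedField 𝕜] [CompleteSpace 𝕜]
    [NormedAddCommGroup X] [NormedSpace 𝕜 X] [NormedAddCommGroup Y] [NormedSpace 𝕜 Y]
    [FiniteDimensional 𝕜 Y] {𝓕 : Filter ι} {A : ι → X →L[𝕜] Y} {A₀ : X →L[𝕜] Y}
    (hA : Filter.Tendsto A 𝓕 (nhds A₀)) :
    ∀ᶠ i in 𝓕, Module.finrank 𝕜 (A₀ : X →ₗ[𝕜] Y).range ≤
      Module.finrank 𝕜 (A i : X →ₗ[𝕜] Y).range := by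
  have := hA.eventually ((isOpen_setOfPred_nat_le_rank (𝕜 := 𝕜) (E := X) (F := Y)
    (Module.finrank 𝕜 (A₀ : X →ₗ[𝕜] Y).range)).mem_nhds
      (by simp [LinearMap.rank, Module.finrank_eq_rank]))
  filter_upwards [this] with i hi
  have hi' : (Module.finrank 𝕜 (A₀ : X →ₗ[𝕜] Y).range : Cardinal) ≤ (A i : X →ₗ[𝕜] Y).rank := hi
  rw [LinearMap.rank, ← Module.finrank_eq_rank] at hi'
  exact_mod_cast hi'

/-- Exactness of a three-term complex of finite-dimensional spaces is an open condition among
complexes. -/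
theorem eventually_exact {𝕜 X Y Z ι : Type*} [NontriviallyNormedField 𝕜] [CompleteSpace 𝕜]
    [NormedAddCommGroup X] [NormedSpace 𝕜 X]
    [NormedAddCommGroup Y] [NormedSpace 𝕜 Y] [NormedAddCommGroup Z] [NormedSpace 𝕜 Z]
    [FiniteDimensional 𝕜 X] [FiniteDimensional 𝕜 Y] [FiniteDimensional 𝕜 Z] {𝓕 : Filter ι}
    {A : ι → X →L[𝕜] Y} {B : ι → Y →L[𝕜] Z} {A₀ : X →L[𝕜] Y} {B₀ : Y →L[𝕜] Z}
    (hA : Filter.Tendsto A 𝓕 (nhds A₀)) (hB : Filter.Tendsto B 𝓕 (nhds B₀))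
    (hBA : ∀ i x, B i (A i x) = 0) (h : ∀ y, B₀ y = 0 → ∃ x, A₀ x = y) :
    ∀ᶠ i in 𝓕, ∀ y, B i y = 0 → ∃ x, A i x = y := by
  filter_upwards [eventually_finrank_range_le hA, eventually_finrank_range_le hB] with i h1 h2 y hy
  have hle : (A i : X →ₗ[𝕜] Y).range ≤ (B i : Y →ₗ[𝕜] Z).ker := by
    rintro _ ⟨x, rfl⟩
    exact hBA i x
  have hle₀ : (B₀ : Y →ₗ[𝕜] Z).ker ≤ (A₀ : X →ₗ[𝕜] Y).range := fun y hy => h y hy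
  have e1 := LinearMap.finrank_range_add_finrank_ker (B i : Y →ₗ[𝕜] Z)
  have e2 := LinearMap.finrank_range_add_finrank_ker (B₀ : Y →ₗ[𝕜] Z)
  have e3 := Submodule.finrank_mono hle₀
  -- dim ker Bᵢ = dim Y - rank Bᵢ ≤ dim Y - rank B₀ = dim ker B₀ ≤ rank A₀ ≤ rank Aᵢ.
  have heq := Submodule.eq_of_le_of_finrank_le hle (by omega)
  have : y ∈ (A i : X →ₗ[𝕜] Y).range := heq ▸ hy
  exact this

/-! ### Continuity of deformations on the whole group -/

/-- The filter of small deformations of `π`. -/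
def deformationFilter {𝕜 Γ E : Type*} [RCLike 𝕜] [Group Γ] [NormedAddCommGroup E]
    [NormedSpace 𝕜 E] (S : Finset Γ) (π : BanachRep 𝕜 Γ E) : Filter (BanachRep 𝕜 Γ E) :=
  Filter.comap (fun (ρ : BanachRep 𝕜 Γ E) (s : S) => ((ρ s : (E →L[𝕜] E)ˣ) : E →L[𝕜] E))
    (nhds fun s => ((π s : (E →L[𝕜] E)ˣ) : E →L[𝕜] E))

section

variable {𝕜 Γ E : Type*} [RCLike 𝕜] [Group Γ] [NormedAddCommGroup E]
    [NormedSpace 𝕜 E] {S : Finset Γ} {π : BanachRep 𝕜 Γ E}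

lemma exists_deformation_of_eventually {p : BanachRep 𝕜 Γ E → Prop}
    (h : ∀ᶠ ρ in deformationFilter S π, p ρ) :
    ∃ ε : ℝ, 0 < ε ∧ ∀ ρ : BanachRep 𝕜 Γ E, IsDeformation S ε π ρ → p ρ := by
  obtain ⟨ε, hε, H⟩ := ((Metric.nhds_basis_closedBall.comap _).eventually_iff).1 h
  refine ⟨ε, hε, fun ρ hρ => H ?_⟩
  rw [Set.mem_preimage, Metric.mem_closedBall, dist_pi_le_iff hε.le]
  intro s
  rw [dist_comm, dist_eq_norm]
  exact hρ s s.2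

/-- Convergence on S passes to words in S. Inverses cause no trouble because, over a complete space,
the units carry the topology induced from the operator norm and inversion of units is continuous. -/
lemma tendsto_deformationFilter [CompleteSpace E] (hS : Subgroup.closure (S : Set Γ) = ⊤) (g : Γ) :
    Filter.Tendsto (fun ρ : BanachRep 𝕜 Γ E => ((ρ g : (E →L[𝕜] E)ˣ) : E →L[𝕜] E))
      (deformationFilter S π) (nhds ((π g : (E →L[𝕜] E)ˣ) : E →L[𝕜] E)) := by
  have hemb := (Units.isOpenEmbedding_val (R := E →L[𝕜] E)).isInducing
  suffices h : Filter.Tendsto (fun ρ : BanachRep 𝕜 Γ E => ρ g) (deformationFilter S π)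
      (nhds (π g)) from (hemb.tendsto_nhds_iff.1 h)
  have hg : g ∈ Subgroup.closure (S : Set Γ) := hS ▸ Subgroup.mem_top g
  induction hg using Subgroup.closure_induction with
  | mem s hs =>
    have := tendsto_pi_nhds.1 (Filter.tendsto_comap (f := fun (ρ : BanachRep 𝕜 Γ E) (s : S) =>
      ((ρ s : (E →L[𝕜] E)ˣ) : E →L[𝕜] E))
      (x := nhds fun s => ((π s : (E →L[𝕜] E)ˣ) : E →L[𝕜] E))) ⟨s, hs⟩
    exact hemb.tendsto_nhds_iff.2 this
  | one => simpa using tendsto_const_nhds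
  | mul x y _ _ hx hy => simpa using hx.mul hy
  | inv x _ hx => simpa using hx.inv

end

lemma List.finite_setOf_length_eq_subset {V : Type*} (t : Finset V) (m : ℕ) :
    {l : List V | l.length = m ∧ ∀ v ∈ l, v ∈ t}.Finite := by
  refine ((List.finite_length_eq t m).image (List.map Subtype.val)).subset ?_
  rintro l ⟨hl, h⟩
  exact ⟨l.attachWith _ h, by simpa using hl, by simp⟩

/-- A sequence of length at most n + 1 spans a simplex of dimension at most n, smaller if vertices
repeat. It can be translated into one of finitely many simplices, and translates share a normal
form. -/
lemma IsEilenbergMacLaneComplex.finite_reps {Γ V : Type*} [Group Γ]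
    [MulAction Γ V] {K : AbstractSimplicialComplex V} {n : ℕ}
    (hK : IsEilenbergMacLaneComplex Γ K n) {γ : V → Γ}
    (hγ : ∀ (g : Γ) v, γ (g • v) = g * γ v) {m : ℕ} (hm : m ≤ n + 1) :
    Finite (ListChain.reps K.lists γ m) := by
  classical
  obtain ⟨F, hF⟩ := hK.finite_skeleton
  refine Set.Finite.to_subtype (((F.finite_toSet.biUnion fun t _ =>
    List.finite_setOf_length_eq_subset t m).image (ListChain.normalForm γ)).subset ?_)
  rintro _ ⟨l, ⟨⟨s, hs, hls⟩, hne, hlm⟩, rfl⟩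
  have hl : l.toFinset ∈ K.faces :=
    K.mem_faces_of_subset hs (fun v hv => hls v (List.mem_toFinset.1 hv)) (by simpa using hne)
  obtain ⟨t, ht, g, hg⟩ := hF _ hl ((List.toFinset_card_le l).trans (by omega))
  refine ⟨l.map (g⁻¹ • ·), Set.mem_biUnion ht ⟨by simpa using hlm, fun v hv => ?_⟩,
    ListChain.normalForm_map hγ _ _⟩
  obtain ⟨w, hw, rfl⟩ := List.mem_map.1 hv
  obtain ⟨x, hx, rfl⟩ := mem_vertexTranslate.1 (hg ▸ List.mem_toFinset.2 hw)
  simpa using hx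

theorem mainTheorem7 {𝕜 Γ E : Type u} [RCLike 𝕜] [Group Γ]
    [NormedAddCommGroup E] [NormedSpace 𝕜 E] [FiniteDimensional 𝕜 E]
    (n : ℕ) (hΓ : IsOfTypeF.{u, v} Γ (n + 1))
    (S : Finset Γ) (hS : Subgroup.closure (S : Set Γ) = ⊤)
    (π : BanachRep 𝕜 Γ E)
    (hπ : Subsingleton (BanachRep.cohomology π n)) :
    ∃ ε : ℝ, 0 < ε ∧ ∀ ρ : BanachRep 𝕜 Γ E, IsDeformation S ε π ρ →
      Subsingleton (BanachRep.cohomology ρ n) := by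
  obtain ⟨V, _, K, hK⟩ := hΓ
  obtain ⟨γ, hQ⟩ := hK.isFreeAcyclic 𝕜
  have hiff : ∀ ρ : BanachRep 𝕜 Γ E, Subsingleton (BanachRep.cohomology ρ n) ↔
      ∀ f, ListChain.coboundary K.lists γ ρ (n + 1) f = 0 →
        ∃ u, ListChain.coboundary K.lists γ ρ n u = f := fun ρ => by
    rw [← ListChain.cohomologyVanishes_iff_coboundary hQ]
    exact (ListChain.subsingleton_groupCohomology_iff_cohomologyVanishes _ n).trans
      ⟨fun h => hQ.cohomologyVanishes ListChain.isFreeAcyclic_univ h,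
        fun h => ListChain.isFreeAcyclic_univ.cohomologyVanishes hQ h⟩
  have hcomplete : CompleteSpace E := FiniteDimensional.complete 𝕜 E
  -- Length n + 2 means dimension n + 1, which is why type F_{n+1} is needed: the target of the
  -- second coboundary must also be finite-dimensional.
  have hfin : ∀ m ≤ n + 2, Finite (ListChain.reps K.lists γ m) := fun m hm =>
    hK.finite_reps hQ.smul hm
  have h0 := hfin n (by omega)
  have h1 := hfin (n + 1) (by omega)
  have h2 := hfin (n + 2) (by omega)
  let _ := Fintype.ofFinite (ListChain.reps K.lists γ n)
  let _ := Fintype.ofFinite (ListChain.reps K.lists γ (n + 1))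
  let _ := Fintype.ofFinite (ListChain.reps K.lists γ (n + 2))
  simp only [hiff]
  exact exists_deformation_of_eventually (eventually_exact
    (ListChain.tendsto_coboundary (tendsto_deformationFilter hS))
    (ListChain.tendsto_coboundary (m := n + 1) (tendsto_deformationFilter hS))
    (fun ρ f => ListChain.coboundary_coboundary hQ ρ f) ((hiff π).1 hπ))
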